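/- Let $G$ be a connected (finite-dimensional, real) Lie group and let $D\subset G$ be a closed subgroup such that $G/D$ carries a non-zero finite $G$-invariant Borel measure. Let $g^{\mathbb R}=(g^t)_{t\in\mathbb R}$ be a one-parameter subgroup of $G$, and let $(G/D,g^{\mathbb R})$ denote the flow $xD\mapsto g^t xD$ on $G/D$. Let $G_1$ be a Lie group, $D_1\subset G_1$ a closed subgroup, $g_1^{\mathbb R}=(g_1^t)_{t\in\mathbb R}$ a one-parameter subgroup of $G_1$, and let $(G_1/D_1,g_1^{\mathbb R})$ be the corresponding flow on $G_1/D_1$. Suppose that $(G/D,g^{\mathbb R})$ projects smoothly onto $(G_1/D_1,g_1^{\mathbb R})$, in the sense that there is a surjective smooth homomorphism $p:G\to G_1$ with $D\subset p^{-1}(D_1)$ and $p(g^t)=g_1^t$ for all $t\in\mathbb R$. A distribution on $G/D$ is a continuous linear functional $T$ on $C_c^\infty(G/D)$. It is called invariant for the flow $(G/D,g^{\mathbb R})$ if its Lie derivative along the flow vanishes, that is, if $T(\mathcal L f)=0$ for all $f\in C_c^\infty(G/D)$, where $(\mathcal L f)(x)=\frac{d}{dt}\big|_{t=0} f(g^t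 x)$. The same definitions apply to $(G_1/D_1,g_1^{\mathbb R})$. The functions and distributions may be taken to be either real-valued or complex-valued. If there exists a countably infinite linearly independent family of invariant distributions for the flow $(G_1/D_1,g_1^{\mathbb R})$, then there exists a countably infinite linearly independent family of invariant distributions for the flow $(G/D,g^{\mathbb R})$. -/

import Mathlib

open scoped Manifold ContDiff

namespace HomogeneousFlow

section SmoothnessOfDerivatives

variable {E : Type*} [NormedAddCommGroup E] [NormedSpace ℝ E]
  {G : Type*} [TopologicalSpace G] [ChartedSpace E G] [IsManifold 𝓘(ℝ, E) ∞ G]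
  {E' : Type*} [NormedAddCommGroup E'] [NormedSpace ℝ E']
  {N : Type*} [TopologicalSpace N] [ChartedSpace E' N] [IsManifold 𝓘(ℝ, E') ∞ N]
  {F : Type*} [NormedAddCommGroup F] [NormedSpace ℝ F]

/-- The partial derivative of a smooth function of two variables, in a fixed direction of the
first variable and at a fixed point, is a smooth function of the second variable. -/
theorem contMDiff_partial_mfderiv (Φ : N × G → F)
    (hΦ : ContMDiff (𝓘(ℝ, E').prod 𝓘(ℝ, E)) 𝓘(ℝ, F) ∞ Φ) (a : N)
    (v : TangentSpace 𝓘(ℝ, E') a) :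
    ContMDiff 𝓘(ℝ, E) 𝓘(ℝ, F) ∞
      (fun x : G => (mfderiv 𝓘(ℝ, E') 𝓘(ℝ, F) (fun b : N => Φ (b, x)) a v : F)) := by
  let fa : G → TangentBundle 𝓘(ℝ, E') N := fun _ ↦ Bundle.TotalSpace.mk' E' a v
  have sfa : ContMDiff 𝓘(ℝ, E) 𝓘(ℝ, E').tangent ∞ fa := contMDiff_const
  let fg : G → TangentBundle 𝓘(ℝ, E) G := fun g ↦ Bundle.TotalSpace.mk' E g 0
  have sfg : ContMDiff 𝓘(ℝ, E) 𝓘(ℝ, E).tangent ∞ fg :=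
    Bundle.contMDiff_zeroSection _ _
  have S₁ := sfa.prodMk sfg
  have S₂ : ContMDiff _ _ ∞ (equivTangentBundleProd 𝓘(ℝ, E') N 𝓘(ℝ, E) G).symm :=
    contMDiff_equivTangentBundleProd_symm
  have S₃ : ContMDiff _ _ ∞ (tangentMap (𝓘(ℝ, E').prod 𝓘(ℝ, E)) 𝓘(ℝ, F) Φ) :=
    ContMDiff.contMDiff_tangentMap hΦ (m := ∞) (by simp)
  have S₄ := (contMDiff_snd_tangentBundle_modelSpace F 𝓘(ℝ, F) (n := ∞)).comp
    ((S₃.comp S₂).comp S₁)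
  refine S₄.congr fun x => ?_
  have hd : MDifferentiableAt (𝓘(ℝ, E').prod 𝓘(ℝ, E)) 𝓘(ℝ, F) Φ (a, x) :=
    hΦ.mdifferentiable (by simp) (a, x)
  have key := mfderiv_prod_eq_add_apply hd (v := ((v, 0) : E' × E))
  have hz : (mfderiv 𝓘(ℝ, E) 𝓘(ℝ, F) (fun z => Φ (a, z)) x) 0 = 0 := map_zero _
  have key' := key.trans ((congrArg _ hz).trans (add_zero _))
  exact key'.symm

end SmoothnessOfDerivatives

section Definitions

variable (𝕜 : Type*) [RCLike 𝕜] (E : Type*) [NormedAddCommGroup E] [NormedSpace ℝ E]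
  {G : Type*} [Group G] [TopologicalSpace G] [ChartedSpace E G]

/-- `G ⧸ D` is a finite volume space: `D` is closed in `G` and `G ⧸ D` carries a nonzero finite
Borel measure invariant under the left translations by the elements of `G`. (Such a measure is
unique up to scaling, and it is automatically given by a smooth density.) -/
structure IsFiniteVolumeSpace {G : Type*} [Group G] [TopologicalSpace G] (D : Subgroup G) :
    Prop where
  isClosed : IsClosed (D : Set G)
  exists_measure : ∃ μ : @MeasureTheory.Measure (G ⧸ D) (borel (G ⧸ D)),
    @MeasureTheory.IsFiniteMeasure _ (borel (G ⧸ D)) μ ∧ μ ≠ 0 ∧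
      @MeasureTheory.SMulInvariantMeasure G (G ⧸ D) _ (borel (G ⧸ D)) μ

variable (G) in
/-- A one-parameter subgroup `(g^t)`, `t ∈ ℝ`, of the Lie group `G`: a smooth homomorphism from
`ℝ` to `G`. -/
structure OneParameterSubgroup where
  toFun : ℝ → G
  map_add' : ∀ s t : ℝ, toFun (s + t) = toFun s * toFun t
  smooth' : ContMDiff 𝓘(ℝ, ℝ) 𝓘(ℝ, E) ∞ toFun

variable {E} in
/-- A one-parameter subgroup sends `0` to the identity. -/
theorem OneParameterSubgroup.map_zero (γ : OneParameterSubgroup E G) : γ.toFun 0 = 1 := by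
  have h := γ.map_add' 0 0
  rw [add_zero] at h
  exact left_eq_mul.mp h

/-- The space `C_c^∞(G/D)` of `𝕜`-valued test functions on `G ⧸ D`. The manifold structure of
`G ⧸ D` is the one for which the projection `G → G ⧸ D` is a smooth submersion, so that a function
on `G ⧸ D` is smooth if and only if its lift to `G` is smooth. -/
def testFunctions (D : Subgroup G) : Submodule 𝕜 (G ⧸ D → 𝕜) where
  carrier := {f | ContMDiff 𝓘(ℝ, E) 𝓘(ℝ, 𝕜) ∞ (fun x : G => f (x : G ⧸ D)) ∧
    HasCompactSupport f}
  zero_mem' := ⟨contMDiff_const, HasCompactSupport.zero⟩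
  add_mem' := fun hf hg => ⟨hf.1.add hg.1, hf.2.add hg.2⟩
  smul_mem' := fun c f hf => by
    refine ⟨?_, hf.2.comp_left (g := fun z => c • z) (by simp)⟩
    exact (ContinuousLinearMap.mul ℝ 𝕜 c).contMDiff.comp hf.1

variable {𝕜 E}
variable [LieGroup 𝓘(ℝ, E) ∞ G] {D : Subgroup G}

/-- A function that depends on a test function `f` on `G ⧸ D` only through the germs of the maps
`b ↦ f (c b • x)`, and vanishes for the zero germ, has compact support. -/
theorem hasCompactSupport_of_germ (E : Type*) [NormedAddCommGroup E] [NormedSpace ℝ E]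
    [ChartedSpace E G] [LieGroup 𝓘(ℝ, E) ∞ G] {N : Type*} [TopologicalSpace N] (c : N → G)
    (hc : Continuous c) (a : N) (ha : c a = 1) {f h : G ⧸ D → 𝕜} (hf : HasCompactSupport f)
    (hh : ∀ x, (fun b => f (c b • x)) =ᶠ[nhds a] (fun _ => 0) → h x = 0) :
    HasCompactSupport h := by
  refine hf.mono' fun x hx => ?_
  by_contra hxf
  refine hx (hh x ?_)
  have hcont : Continuous fun b => c b • x := by
    induction x using QuotientGroup.induction_on with
    | H y =>
      have h1 : Continuous fun b : N => c b * y :=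
        ((contMDiff_mul_right (I := 𝓘(ℝ, E)) (n := ∞) (a := y)).continuous).comp hc
      exact continuous_quotient_mk'.comp h1
  have h2 : f =ᶠ[nhds (c a • x)] 0 := by
    rw [ha, one_smul]
    exact notMem_tsupport_iff_eventuallyEq.mp hxf
  exact hcont.continuousAt.eventually h2

/-- The infinitesimal action of a vector `v` of the Lie algebra of `G` on test functions: the
derivative of `f` along the vector field on `G ⧸ D` that `v` generates through the left action
of `G`, that is `x ↦ d/ds f (g_s • x)` at `s = 0` for any curve `g_s` in `G` that passes
through `1` with velocity `v`. -/
noncomputable def derivAlong (v : GroupLieAlgebra 𝓘(ℝ, E) G) (f : testFunctions 𝕜 E D) :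
    testFunctions 𝕜 E D where
  val := fun x => (mfderiv 𝓘(ℝ, E) 𝓘(ℝ, 𝕜) (fun g : G => f.1 (g • x)) 1 v : 𝕜)
  property := by
    constructor
    · exact contMDiff_partial_mfderiv (E := E) (E' := E) (F := 𝕜)
        (fun p : G × G => f.1 ((p.1 * p.2 : G) : G ⧸ D))
        (f.2.1.comp (contMDiff_mul 𝓘(ℝ, E) ∞)) 1 v
    · refine hasCompactSupport_of_germ E id continuous_id 1 rfl f.2.2 fun x hx => ?_
      have h0 := hx.mfderiv_eq (I := 𝓘(ℝ, E)) (I' := 𝓘(ℝ, 𝕜))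
      rw [mfderiv_const] at h0
      exact DFunLike.congr_fun h0 v

/-- The Lie derivative of a test function along the flow `x ↦ g^t • x` on `G ⧸ D` generated by
a one-parameter subgroup. -/
noncomputable def lieDerivative (γ : OneParameterSubgroup E G) (f : testFunctions 𝕜 E D) :
    testFunctions 𝕜 E D where
  val := fun x => deriv (fun t : ℝ => f.1 (γ.toFun t • x)) 0
  property := by
    constructor
    · have := contMDiff_partial_mfderiv (E := E) (E' := ℝ) (F := 𝕜)
        (fun p : ℝ × G => f.1 ((γ.toFun p.1 * p.2 : G) : G ⧸ D))
        (f.2.1.comp ((γ.smooth'.comp contMDiff_fst).mul contMDiff_snd)) 0 (1 : ℝ)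
      simp only [mfderiv_eq_fderiv] at this
      exact this
    · refine hasCompactSupport_of_germ E γ.toFun γ.smooth'.continuous 0 γ.map_zero
        f.2.2 fun x hx => ?_
      rw [hx.deriv_eq, deriv_const]

/-- The derivative defining the Lie derivative always exists. -/
theorem hasDerivAt_lieDerivative (γ : OneParameterSubgroup E G) (f : testFunctions 𝕜 E D)
    (x : G ⧸ D) :
    HasDerivAt (fun t : ℝ => f.1 (γ.toFun t • x)) ((lieDerivative γ f).1 x) 0 := by
  refine DifferentiableAt.hasDerivAt ?_
  induction x using QuotientGroup.induction_on with
  | H y =>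
    have h : ContMDiff 𝓘(ℝ, ℝ) 𝓘(ℝ, 𝕜) ∞
        (fun t : ℝ => f.1 ((γ.toFun t * y : G) : G ⧸ D)) :=
      f.2.1.comp (γ.smooth'.mul contMDiff_const)
    exact (h.contDiff.differentiable (by simp)) 0

/-- The iterated derivative `v₁ v₂ ⋯ v_k f` of a test function along a word `[v₁, …, v_k]` of
vectors of the Lie algebra of `G`. -/
noncomputable def iteratedDerivAlong (w : List (GroupLieAlgebra 𝓘(ℝ, E) G))
    (f : testFunctions 𝕜 E D) : testFunctions 𝕜 E D :=
  w.foldr derivAlong f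

variable (𝕜 E D) in
/-- The space `𝒟'(G/D)` of distributions on `G ⧸ D`: the linear functionals `T` on the space of
test functions such that, for each compact set `K`, on the test functions supported in `K` the
modulus of `T f` is bounded by a multiple of the largest of the uniform norms of finitely many
iterated derivatives of `f`. (As `G` acts transitively, the vector fields generated by the Lie
algebra of `G` span all tangent spaces of `G ⧸ D`, so that the uniform norms of the iterated
derivatives along them define the usual `C^∞` topology on the functions supported in `K`.) -/
def distributions : Submodule 𝕜 (Module.Dual 𝕜 (testFunctions 𝕜 E D)) where
  carrier := {T | ∀ K : Set (G ⧸ D), IsCompact K →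
    ∃ (S : Finset (List (GroupLieAlgebra 𝓘(ℝ, E) G))) (C : ℝ),
      ∀ f : testFunctions 𝕜 E D, tsupport f.1 ⊆ K →
        ∀ B : ℝ, (∀ w ∈ S, ∀ x, ‖(iteratedDerivAlong w f).1 x‖ ≤ B) → ‖T f‖ ≤ C * B}
  zero_mem' := fun K _ => ⟨∅, 0, fun f _ B _ => by simp⟩
  add_mem' := fun {T T'} hT hT' K hK => by
    classical
    obtain ⟨S, C, h⟩ := hT K hK
    obtain ⟨S', C', h'⟩ := hT' K hK
    refine ⟨S ∪ S', C + C', fun f hf B hB => ?_⟩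
    have h1 := h f hf B fun w hw => hB w (Finset.mem_union_left _ hw)
    have h2 := h' f hf B fun w hw => hB w (Finset.mem_union_right _ hw)
    calc ‖(T + T') f‖ ≤ ‖T f‖ + ‖T' f‖ := norm_add_le _ _
      _ ≤ (C + C') * B := by linarith
  smul_mem' := fun c T hT K hK => by
    obtain ⟨S, C, h⟩ := hT K hK
    refine ⟨S, ‖c‖ * C, fun f hf B hB => ?_⟩
    calc ‖(c • T) f‖ = ‖c‖ * ‖T f‖ := by
          rw [LinearMap.smul_apply, smul_eq_mul, norm_mul]
      _ ≤ ‖c‖ * (C * B) := mul_le_mul_of_nonneg_left (h f hf B hB) (norm_nonneg _)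
      _ = ‖c‖ * C * B := by ring

/-- A distribution on `G ⧸ D` is invariant for the flow `(G ⧸ D, g^ℝ)` if its Lie derivative along
the flow vanishes in the sense of distributions. -/
def IsInvariant (γ : OneParameterSubgroup E G) (T : distributions 𝕜 E D) : Prop :=
  ∀ f : testFunctions 𝕜 E D, T.1 (lieDerivative γ f) = 0

variable (𝕜 D) in
/-- The flow `(G ⧸ D, g^ℝ)` has countably many (that is, a countably infinite family of) linearly
independent invariant distributions. -/
def HasCountablyManyInvariantDistributions (γ : OneParameterSubgroup E G) : Prop :=
  ∃ T : ℕ → distributions 𝕜 E D, LinearIndependent 𝕜 T ∧ ∀ n, IsInvariant γ (T n)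

end Definitions

end HomogeneousFlow

/-! Invariant distributions are pulled back along `π : G ⧸ D → G₁ ⧸ D₁` by the dual of integration
along the fibres. Disintegrating the finite invariant measure over `π` yields a probability measure
`l` on the fibre over the base point, invariant under `p⁻¹(D₁)`
(`exists_stabilizer_invariant_measure`). Hence `P f (p g · D₁) = ∫ f (g • x) dl(x)` does not depend
on the lift `g` (`fiberIntegral_mk`).

The map `P` sends test functions to test functions. Smoothness comes from local sections of `p`
(`exists_smooth_local_section`) and differentiation under the integral. For the sections, `p` is
open by a Baire category argument, and an open smooth map is a submersion where its rank is maximal;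
translation moves that point to the identity. Sections also lift Lie algebra vectors, so that
derivatives of `P f` are `P` of derivatives of `f`. As `l` has mass one, `P` does not increase
uniform norms, and `T ∘ P` is again a distribution. Since `p` intertwines the one-parameter
subgroups, `P` commutes with the Lie derivatives and `T ∘ P` inherits invariance.

Finally `P` is onto (`fiberPush_surjective`): if `P u` has no zero on the support of `φ`, then `φ =
P (u · (φ / P u) ∘ π)`. So `T ↦ T ∘ P` is injective and preserves linear independence. -/

set_option linter.unusedSectionVars false

/-! ### Disintegration of invariant measures over homogeneous spaces -/

section Disintegration

open MeasureTheory ProbabilityTheory Topology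

/-- The space is σ-compact, hence a Borel subset of its completion for a compatible metric, and a
Borel subset of a Polish space is standard Borel. Conditional distributions on `G ⧸ D` need this. -/
theorem standardBorelSpace_of_locallyCompact (X : Type*) [TopologicalSpace X] [T2Space X]
    [LocallyCompactSpace X] [SecondCountableTopology X] [MeasurableSpace X] [BorelSpace X] :
    StandardBorelSpace X := by
  let _ := TopologicalSpace.metrizableSpaceMetric X
  let _ : MeasurableSpace (UniformSpace.Completion X) := borel _
  have : BorelSpace (UniformSpace.Completion X) := ⟨rfl⟩
  have hemb : IsEmbedding ((↑) : X → UniformSpace.Completion X) :=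
    UniformSpace.Completion.isUniformEmbedding_coe X |>.isEmbedding
  have hrange : MeasurableSet (Set.range ((↑) : X → UniformSpace.Completion X)) := by
    rw [← Set.image_univ, ← iUnion_compactCovering, Set.image_iUnion]
    exact MeasurableSet.iUnion fun n =>
      ((isCompact_compactCovering X n).image hemb.continuous).isClosed.measurableSet
  have hme := hemb.measurableEmbedding hrange
  obtain ⟨t, ht1, ht2⟩ := hrange.standardBorel.polish
  have hp := @Equiv.polishSpace_induced X _ t ht2 hme.equivRange.toEquiv
  have hb : ‹MeasurableSpace X› = @borel X (t.induced hme.equivRange) := by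
    rw [borel_comap, ← ht1.measurable_eq]
    exact hme.equivRange.measurableEmbedding.comap_eq.symm
  exact ⟨t.induced hme.equivRange, @BorelSpace.mk X (t.induced hme.equivRange) _ hb, hp⟩

/-- The conditional distributions of an invariant measure along an equivariant map are
equivariant, almost everywhere for each group element. -/
theorem ae_condDistrib_smul {G X Y : Type*} [Group G] [MulAction G X] [MulAction G Y]
    [MeasurableSpace X] [StandardBorelSpace X] [Nonempty X] [MeasurableSpace Y]
    [MeasurableConstSMul G X] [MeasurableConstSMul G Y]
    (μ : Measure X) [IsFiniteMeasure μ] [SMulInvariantMeasure G X μ]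
    {π : X → Y} (hπ : Measurable π) (hequiv : ∀ (g : G) x, π (g • x) = g • π x) (g : G) :
    ∀ᵐ y ∂(μ.map π), condDistrib id π μ (g • y) = (condDistrib id π μ y).map (g • ·) := by
  set κ := condDistrib (id : X → X) π μ
  set ν := μ.map π with hν
  have hg : ∀ g : G, MeasurePreserving (g • · : Y → Y) ν ν := by
    refine fun g => ⟨measurable_const_smul g, ?_⟩
    rw [hν, Measure.map_map (measurable_const_smul g) hπ]
    have h1 : (g • · : Y → Y) ∘ π = π ∘ (g • · : X → X) := by
      funext x; exact (hequiv g x).symm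
    rw [h1, ← Measure.map_map hπ (measurable_const_smul g), MeasureTheory.map_smul]
  have hρ : ν ⊗ₘ κ = μ.map fun x => (π x, x) := compProd_map_condDistrib aemeasurable_id
  -- Invariance of `μ` makes the conjugated kernel `κ'` another disintegration of the same measure;
  -- almost everywhere uniqueness identifies it with `κ`.
  let κ' : Kernel Y X := (κ.comap (g • ·) (measurable_const_smul g)).map (g⁻¹ • ·)
  have hκ' : ∀ y, κ' y = (κ (g • y)).map (g⁻¹ • ·) := fun y => by
    simp only [κ']
    rw [Kernel.map_apply _ (measurable_const_smul _), Kernel.comap_apply]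
  have key : κ =ᵐ[ν] κ' := by
    refine condDistrib_ae_eq_of_measure_eq_compProd π aemeasurable_id ?_
    ext S hS
    let S' : Set (Y × X) := (fun q : Y × X => (g⁻¹ • q.1, g⁻¹ • q.2)) ⁻¹' S
    have hmeas : Measurable fun q : Y × X => (g⁻¹ • q.1, g⁻¹ • q.2) :=
      (measurable_fst.const_smul g⁻¹).prodMk (measurable_snd.const_smul g⁻¹)
    have hS' : MeasurableSet S' := hmeas hS
    have hpair : Measurable fun x => (π x, x) := hπ.prodMk measurable_id
    rw [Measure.compProd_apply hS]
    have h2 : ∀ y, κ' y (Prod.mk y ⁻¹' S) = κ (g • y) (Prod.mk (g • y) ⁻¹' S') := by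
      intro y
      rw [hκ', Measure.map_apply (measurable_const_smul _) (measurable_prodMk_left hS)]
      congr 1
      ext x
      simp [S']
    simp_rw [h2]
    rw [(hg g).lintegral_comp (f := fun y => κ y (Prod.mk y ⁻¹' S'))
      (Kernel.measurable_kernel_prodMk_left hS'), ← Measure.compProd_apply hS', hρ,
      Measure.map_apply hpair hS']
    simp only [id]
    rw [Measure.map_apply hpair hS, ← measure_preimage_smul μ g⁻¹]
    congr 1
    ext x
    simp [S', hequiv]
  filter_upwards [key] with y hy
  rw [hy, hκ', Measure.map_map (measurable_const_smul _) (measurable_const_smul _)]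
  simp [Function.comp_def]

/-- A finite invariant measure on a space with an equivariant map to a homogeneous space
disintegrates: each fibre carries a probability measure that is invariant under the stabilizer. -/
theorem exists_stabilizer_invariant_measure {G X Y : Type*} [Group G] [TopologicalSpace G]
    [IsTopologicalGroup G] [LocallyCompactSpace G] [SecondCountableTopology G]
    [MeasurableSpace G] [BorelSpace G]
    [TopologicalSpace X] [SecondCountableTopology X] [MeasurableSpace X] [BorelSpace X]
    [StandardBorelSpace X] [TopologicalSpace Y] [SecondCountableTopology Y] [T2Space Y]
    [MeasurableSpace Y] [BorelSpace Y] [MulAction G X] [ContinuousSMul G X]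
    [MulAction G Y] [ContinuousSMul G Y] [MulAction.IsPretransitive G Y]
    (μ : Measure X) [IsFiniteMeasure μ] (hμ : μ ≠ 0) [SMulInvariantMeasure G X μ]
    {π : X → Y} (hπ : Continuous π) (hequiv : ∀ (g : G) x, π (g • x) = g • π x) (o : Y) :
    ∃ l : Measure X, IsProbabilityMeasure l ∧ (∀ᵐ x ∂l, π x = o) ∧
      ∀ g : G, g • o = o → l.map (g • ·) = l := by
  have : Nonempty X := by
    by_contra hne
    rw [not_nonempty_iff] at hne
    exact hμ (Measure.eq_zero_of_isEmpty μ)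
  set κ := condDistrib (id : X → X) π μ
  set ν := μ.map π with hν
  have hν0 : ν ≠ 0 := by
    rwa [hν, ne_eq, Measure.map_eq_zero_iff hπ.measurable.aemeasurable]
  let m : Measure G := Measure.haar
  -- A countable generating π-system reduces equality of two measures to countably many conditions,
  -- so that the set of good pairs `(y, g)` is measurable and Fubini applies to it.
  obtain ⟨C, hCc, hCgen, hCpi⟩ : ∃ C : Set (Set X), C.Countable ∧
      ‹MeasurableSpace X› = MeasurableSpace.generateFrom C ∧ IsPiSystem C := by
    obtain ⟨b, hb, hgen⟩ := MeasurableSpace.CountablyGenerated.isCountablyGenerated (α := X)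
    exact ⟨_, countable_generateSetAlgebra hb, by
      rw [hgen, generateFrom_generateSetAlgebra_eq],
      fun s hs t ht _ => isSetAlgebra_generateSetAlgebra.inter_mem hs ht⟩
  have hCm : ∀ s ∈ C, MeasurableSet s := fun s hs => by
    rw [hCgen]; exact MeasurableSpace.measurableSet_generateFrom hs
  have hiff : ∀ (g : G) (y : Y), κ (g • y) = (κ y).map (g • ·) ↔
      ∀ s ∈ C, κ (g • y) s = κ y {x | g • x ∈ s} := by
    intro g y
    constructor
    · intro h s hs
      rw [h, Measure.map_apply (measurable_const_smul g) (hCm s hs)]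
      rfl
    · intro h
      have : IsProbabilityMeasure ((κ y).map (g • ·)) :=
        Measure.isProbabilityMeasure_map (measurable_const_smul g).aemeasurable
      refine ext_of_generate_finite C hCgen hCpi (fun s hs => ?_) (by simp)
      rw [h s hs, Measure.map_apply (measurable_const_smul g) (hCm s hs)]
      rfl
  have hmeas : MeasurableSet {q : Y × G | κ (q.2 • q.1) = (κ q.1).map (q.2 • ·)} := by
    simp_rw [hiff]
    have : {q : Y × G | ∀ s ∈ C, κ (q.2 • q.1) s = κ q.1 {x | q.2 • x ∈ s}} =
        ⋂ s ∈ C, {q : Y × G | κ (q.2 • q.1) s = κ q.1 {x | q.2 • x ∈ s}} := by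
      ext q; simp
    rw [this]
    refine MeasurableSet.biInter hCc fun s hs => measurableSet_eq_fun ?_ ?_
    · exact (Kernel.measurable_coe κ (hCm s hs)).comp (measurable_snd.smul measurable_fst)
    · have h1 : MeasurableSet {r : (Y × G) × X | r.1.2 • r.2 ∈ s} :=
        ((measurable_snd.comp measurable_fst).smul measurable_snd) (hCm s hs)
      have := Kernel.measurable_kernel_prodMk_left
        (κ := κ.comap (Prod.fst : Y × G → Y) measurable_fst) h1
      exact this
  -- Equivariance holds for each `g` outside a null set of `y` that depends on `g`; exchanging the
  -- quantifiers gives a single `y` that is good for Haar-almost every `g`.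
  have hae1 : ∀ᵐ y ∂ν, ∀ᵐ g ∂m, κ (g • y) = (κ y).map (g • ·) := by
    rw [Measure.ae_ae_comm hmeas]
    exact Filter.Eventually.of_forall fun g =>
      ae_condDistrib_smul μ hπ.measurable hequiv g
  have hae2 : ∀ᵐ y ∂ν, ∀ᵐ x ∂(κ y), π x = y := by
    have hset : MeasurableSet {q : Y × X | π q.2 = q.1} :=
      measurableSet_eq_fun (hπ.measurable.comp measurable_snd) measurable_fst
    refine Measure.ae_ae_of_ae_compProd (p := fun q : Y × X => π q.2 = q.1) ?_
    rw [compProd_map_condDistrib aemeasurable_id,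
      ae_map_iff (hπ.measurable.prodMk measurable_id).aemeasurable hset]
    exact Filter.Eventually.of_forall fun x => rfl
  have hprob : ∀ y, IsProbabilityMeasure (κ y) := inferInstance
  clear_value κ ν
  have : (ae ν).NeBot := ae_neBot.mpr hν0
  obtain ⟨y, hy1, hy2⟩ := (hae1.and hae2).exists
  -- Right translation by `h` preserves Haar-null sets, so some `g` has both `g` and `g * h` good.
  -- Both carry `y` to `g • y`, and cancelling `g` gives exact invariance under every `h` in the
  -- stabilizer.
  have hstab : ∀ h : G, h • y = y → (κ y).map (h • ·) = κ y := by
    intro h hh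
    have hy3 : ∀ᵐ g ∂m, κ ((g * h) • y) = (κ y).map ((g * h) • ·) := by
      have hq : Measure.QuasiMeasurePreserving (fun g : G => g * h) m m :=
        quasiMeasurePreserving_mul_right m h
      exact hq.ae (p := fun g => κ (g • y) = (κ y).map (g • ·)) hy1
    have : (ae m).NeBot := ae_neBot.mpr (NeZero.ne m)
    obtain ⟨g, hg1, hg2⟩ := (hy1.and hy3).exists
    rw [mul_smul, hh, hg1] at hg2
    have : ((κ y).map (g • ·)).map (g⁻¹ • ·) = ((κ y).map ((g * h) • ·)).map (g⁻¹ • ·) := by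
      rw [hg2]
    rw [Measure.map_map (measurable_const_smul _) (measurable_const_smul _),
      Measure.map_map (measurable_const_smul _) (measurable_const_smul _)] at this
    simp only [Function.comp_def, inv_smul_smul, mul_smul, Measure.map_id'] at this
    exact this.symm
  obtain ⟨g, rfl⟩ := MulAction.exists_smul_eq G y o
  refine ⟨(κ y).map (g • ·),
    Measure.isProbabilityMeasure_map (measurable_const_smul g).aemeasurable, ?_, ?_⟩
  · rw [ae_map_iff (measurable_const_smul g).aemeasurable
      (measurableSet_eq_fun hπ.measurable measurable_const)]
    filter_upwards [hy2] with x hx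
    rw [hequiv, hx]
  · intro h hh
    have := hstab (g⁻¹ * h * g) (by rw [mul_smul, mul_smul, hh, inv_smul_smul])
    rw [Measure.map_map (measurable_const_smul _) (measurable_const_smul _)]
    conv_rhs => rw [← this]
    rw [Measure.map_map (measurable_const_smul _) (measurable_const_smul _)]
    congr 1
    funext x
    simp [mul_smul]

end Disintegration

/-! ### Smooth dependence of integrals on parameters -/

section ParametricIntegrals

open MeasureTheory Topology

section ParametricIntegral

variable {𝕜 : Type*} [RCLike 𝕜]
  {V : Type*} [NormedAddCommGroup V] [NormedSpace ℝ V]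
  {E : Type*} [NormedAddCommGroup E] [NormedSpace ℝ E]
  {M : Type*} [TopologicalSpace M] [ChartedSpace E M]
  {X : Type*} [TopologicalSpace X]

/-- A family `Φ e` of functions on a quotient `X` of a manifold `M`, with a parameter `e` in a
normed space, that is jointly smooth (as a function on `V × M`) and whose members have, locally
in `e`, their supports in a common compact set. -/
structure IsSmoothFamily (q : M → X) (Φ : V → X → 𝕜) : Prop where
  smooth : ContMDiff (𝓘(ℝ, V).prod 𝓘(ℝ, E)) 𝓘(ℝ, 𝕜) ∞ fun r : V × M => Φ r.1 (q r.2)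
  support : ∀ e : V, ∃ K : Set X, IsCompact K ∧ ∀ᶠ e' in 𝓝 e, ∀ x ∉ K, Φ e' x = 0

namespace IsSmoothFamily

variable {q : M → X} {Φ : V → X → 𝕜}

include E in
theorem contDiff (h : IsSmoothFamily (E := E) q Φ) (hq : Function.Surjective q) (x : X) :
    ContDiff ℝ ∞ fun e => Φ e x := by
  obtain ⟨y, rfl⟩ := hq x
  exact (h.smooth.comp (contMDiff_id.prodMk contMDiff_const)).contDiff

include E in
theorem contMDiff_fderiv [IsManifold 𝓘(ℝ, E) ∞ M] (h : IsSmoothFamily (E := E) q Φ) :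
    ContMDiff (𝓘(ℝ, V).prod 𝓘(ℝ, E)) 𝓘(ℝ, V →L[ℝ] 𝕜) ∞
      fun r : V × M => fderiv ℝ (fun e => Φ e (q r.2)) r.1 := by
  intro r
  have h1 : ContMDiff (((𝓘(ℝ, V).prod 𝓘(ℝ, E)).prod 𝓘(ℝ, V))) 𝓘(ℝ, 𝕜) ∞
      (Function.uncurry fun (r : V × M) (e : V) => Φ e (q r.2)) :=
    h.smooth.comp (contMDiff_snd.prodMk (contMDiff_snd.comp contMDiff_fst))
  have h2 := ContMDiffAt.mfderiv (x₀ := r) (m := ∞)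
    (fun (r : V × M) (e : V) => Φ e (q r.2)) Prod.fst (h1 (r, r.1)) contMDiffAt_fst (by simp)
  have h3 := inTangentCoordinates_model_space (I := 𝓘(ℝ, V)) (I' := 𝓘(ℝ, 𝕜)) Prod.fst
    (fun r : V × M => Φ r.1 (q r.2)) (fun r => fderiv ℝ (fun e => Φ e (q r.2)) r.1) r
  rw [← h3]
  simpa only [mfderiv_eq_fderiv] using h2

include E in
-- Openness of `q` matters here: its product with the identity is again a quotient map, so
-- continuity can be tested on `V × M`.
theorem continuous_fderiv [IsManifold 𝓘(ℝ, E) ∞ M] (h : IsSmoothFamily (E := E) q Φ)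
    (hq : IsOpenQuotientMap q) :
    Continuous fun r : V × X => fderiv ℝ (fun e => Φ e r.2) r.1 := by
  rw [← (IsOpenQuotientMap.id.prodMap hq).continuous_comp_iff]
  exact h.contMDiff_fderiv.continuous

include E in
theorem continuous (h : IsSmoothFamily (E := E) q Φ)
    (hq : IsOpenQuotientMap q) : Continuous fun r : V × X => Φ r.1 r.2 := by
  rw [← (IsOpenQuotientMap.id.prodMap hq).continuous_comp_iff]
  exact h.smooth.continuous

/-- This closure property drives the induction in `contDiff_integral`. The support condition
survives differentiation because one compact set serves a whole neighbourhood of parameters. -/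
theorem fderiv_apply [IsManifold 𝓘(ℝ, E) ∞ M] (h : IsSmoothFamily (E := E) q Φ) (v : V) :
    IsSmoothFamily (E := E) q fun e x => fderiv ℝ (fun e => Φ e x) e v where
  smooth := h.contMDiff_fderiv.clm_apply contMDiff_const
  support e := by
    obtain ⟨K, hK, hKs⟩ := h.support e
    refine ⟨K, hK, ?_⟩
    filter_upwards [eventually_eventually_nhds.mpr hKs] with e' he' x hx
    have : (fun e => Φ e x) =ᶠ[𝓝 e'] fun _ => 0 := by
      filter_upwards [he'] with e'' he'' using he'' x hx
    rw [this.fderiv_eq]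
    simp

variable [MeasurableSpace X] [BorelSpace X] [T2Space X]

include E in
theorem integrable [IsManifold 𝓘(ℝ, E) ∞ M] (h : IsSmoothFamily (E := E) q Φ)
    (hq : IsOpenQuotientMap q) (l : Measure X) [IsFiniteMeasureOnCompacts l] (e : V) :
    Integrable (Φ e) l := by
  obtain ⟨K, hK, hKs⟩ := h.support e
  have hc : Continuous (Φ e) := (h.continuous hq).comp (continuous_const.prodMk continuous_id)
  refine hc.integrable_of_hasCompactSupport (HasCompactSupport.intro hK fun x hx => ?_)
  exact hKs.self_of_nhds x hx

include E in
theorem integrable_fderiv [IsManifold 𝓘(ℝ, E) ∞ M] (h : IsSmoothFamily (E := E) q Φ)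
    (hq : IsOpenQuotientMap q) (l : Measure X) [IsFiniteMeasureOnCompacts l] (e : V) :
    Integrable (fun x => fderiv ℝ (fun e => Φ e x) e) l := by
  obtain ⟨K, hK, hKs⟩ := h.support e
  have hc : Continuous fun x => fderiv ℝ (fun e => Φ e x) e :=
    (h.continuous_fderiv hq).comp (continuous_const.prodMk continuous_id)
  refine hc.integrable_of_hasCompactSupport (HasCompactSupport.intro hK fun x hx => ?_)
  have : (fun e => Φ e x) =ᶠ[𝓝 e] fun _ => 0 := by
    filter_upwards [hKs] with e'' he'' using he'' x hx
  rw [this.fderiv_eq]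
  simp

variable [FiniteDimensional ℝ V]

include E in
theorem hasFDerivAt_integral [IsManifold 𝓘(ℝ, E) ∞ M] (h : IsSmoothFamily (E := E) q Φ)
    (hq : IsOpenQuotientMap q) (l : Measure X) [IsFiniteMeasureOnCompacts l] (e : V) :
    HasFDerivAt (fun e => ∫ x, Φ e x ∂l) (∫ x, fderiv ℝ (fun e => Φ e x) e ∂l) e := by
  obtain ⟨K, hK, hKs⟩ := h.support e
  -- On the compact set `B ×ˢ K` the derivative is bounded by some `C`, and for parameters in `B` it
  -- vanishes off `K`; the integrable dominating function is `C` times the indicator of `K`.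
  obtain ⟨B, hB, hBc, hBs⟩ : ∃ B ∈ 𝓝 e, IsCompact B ∧ ∀ e' ∈ B, ∀ᶠ e'' in 𝓝 e', ∀ x ∉ K,
      Φ e'' x = 0 := by
    obtain ⟨B, hB, hBs, hBc⟩ :=
      local_compact_nhds (eventually_eventually_nhds.mpr hKs)
    exact ⟨B, hB, hBc, fun e' he' => hBs he'⟩
  have hF'c := h.continuous_fderiv hq
  obtain ⟨C, hC⟩ := (hBc.prod hK).exists_bound_of_continuousOn hF'c.continuousOn
  have hzero : ∀ e' ∈ B, ∀ x ∉ K, fderiv ℝ (fun e => Φ e x) e' = 0 := fun e' he' x hx => by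
    have : (fun e => Φ e x) =ᶠ[𝓝 e'] fun _ => 0 := by
      filter_upwards [hBs e' he'] with e'' he'' using he'' x hx
    rw [this.fderiv_eq]
    simp
  refine hasFDerivAt_integral_of_dominated_of_fderiv_le (𝕜 := ℝ)
    (F' := fun e x => fderiv ℝ (fun e => Φ e x) e) (bound := K.indicator fun _ => C) hB ?_
    (h.integrable hq l e) ?_ ?_ ?_ ?_
  · exact Filter.Eventually.of_forall fun e' => (h.integrable hq l e').aestronglyMeasurable
  · exact (hF'c.comp (continuous_const.prodMk continuous_id)).aestronglyMeasurable
  · refine Filter.Eventually.of_forall fun x e' he' => ?_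
    by_cases hx : x ∈ K
    · rw [Set.indicator_of_mem hx]
      exact hC (e', x) ⟨he', hx⟩
    · rw [Set.indicator_of_notMem hx, hzero e' he' x hx, norm_zero]
  · exact (integrable_indicator_iff hK.measurableSet).mpr
      (integrableOn_const hK.measure_lt_top.ne)
  · exact Filter.Eventually.of_forall fun x e' _ =>
      (((h.contDiff hq.surjective x).differentiable (by simp)) e').hasFDerivAt

include E in
/-- Differentiation under the integral sign. -/
theorem fderiv_integral_apply [IsManifold 𝓘(ℝ, E) ∞ M] (h : IsSmoothFamily (E := E) q Φ)
    (hq : IsOpenQuotientMap q) (l : Measure X) [IsFiniteMeasureOnCompacts l] (e v : V) :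
    fderiv ℝ (fun e => ∫ x, Φ e x ∂l) e v = ∫ x, fderiv ℝ (fun e => Φ e x) e v ∂l := by
  rw [(h.hasFDerivAt_integral hq l e).fderiv,
    ContinuousLinearMap.integral_apply (h.integrable_fderiv hq l e)]

include E in
theorem contDiff_integral [IsManifold 𝓘(ℝ, E) ∞ M] (h : IsSmoothFamily (E := E) q Φ)
    (hq : IsOpenQuotientMap q) (l : Measure X) [IsFiniteMeasureOnCompacts l] :
    ContDiff ℝ ∞ fun e => ∫ x, Φ e x ∂l := by
  rw [contDiff_infty]
  intro n
  induction n generalizing Φ with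
  | zero =>
    exact contDiff_zero.mpr (continuous_iff_continuousAt.mpr fun e =>
      (h.hasFDerivAt_integral hq l e).continuousAt)
  | succ n ih =>
    push_cast
    refine contDiff_succ_iff_fderiv_apply.mpr
      ⟨fun e => (h.hasFDerivAt_integral hq l e).differentiableAt, by simp, fun v => ?_⟩
    simp_rw [h.fderiv_integral_apply hq l]
    exact ih (h.fderiv_apply v)

end IsSmoothFamily

end ParametricIntegral

end ParametricIntegrals

/-! ### Open maps are submersions somewhere -/

section OpenMaps

open Topology

/-- Let `q` be a linear map such that the kernels of the derivatives `f' x` and `q ∘ f' x`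
agree for `x` near `x₀`, and such that `q ∘ f' x₀` is surjective. Then `f` is determined by
`q ∘ f` locally. -/
theorem exists_nhds_forall_eq_of_ker_le {E F R : Type*} [NormedAddCommGroup E] [NormedSpace ℝ E]
    [FiniteDimensional ℝ E] [NormedAddCommGroup F] [NormedSpace ℝ F]
    [NormedAddCommGroup R] [NormedSpace ℝ R] [FiniteDimensional ℝ R]
    {f : E → F} {x₀ : E} {q : F →L[ℝ] R} (hf : ∀ᶠ x in 𝓝 x₀, ContDiffAt ℝ 1 f x)
    (hker : ∀ᶠ x in 𝓝 x₀, ∀ w, q (fderiv ℝ f x w) = 0 → fderiv ℝ f x w = 0)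
    (hsurj : (q.comp (fderiv ℝ f x₀)).range = ⊤) :
    ∃ U ∈ 𝓝 x₀, ∀ x ∈ U, ∀ y ∈ U, q (f x) = q (f y) → f x = f y := by
  set A := q.comp (fderiv ℝ f x₀) with hA
  obtain ⟨N, hN⟩ := A.ker.exists_isCompl
  let s : E →ₗ[ℝ] A.ker := Submodule.projectionOnto _ _ hN
  have hsk : ∀ k : A.ker, s k = k := Submodule.projectionOnto_apply_left hN
  let S : E →L[ℝ] A.ker := LinearMap.toContinuousLinearMap s
  -- Completing `q ∘ f` by a projection onto the kernel of its derivative gives a local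
  -- diffeomorphism. In these coordinates `f` turns out to depend on the first one only.
  let Φ : E → R × A.ker := fun x => (q (f x), S x)
  let Φ' : E → E →L[ℝ] R × A.ker := fun x => (q.comp (fderiv ℝ f x)).prod S
  have hΦ' : ∀ x, ContDiffAt ℝ 1 f x → HasFDerivAt Φ (Φ' x) x := fun x hx =>
    (q.hasFDerivAt.comp x (hx.differentiableAt (by simp)).hasFDerivAt).prodMk S.hasFDerivAt
  have hΦC : ContDiffAt ℝ 1 Φ x₀ :=
    (q.contDiff.contDiffAt.comp x₀ hf.self_of_nhds).prodMk S.contDiff.contDiffAt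
  have hker0 : (Φ' x₀).ker = ⊥ := by
    rw [LinearMap.ker_eq_bot']
    intro w hw
    have h1 : A w = 0 := congrArg Prod.fst hw
    have h2 : s w = 0 := congrArg Prod.snd hw
    have h3 : s w = ⟨w, h1⟩ := hsk ⟨w, h1⟩
    rw [h2] at h3
    exact (congrArg Subtype.val h3).symm
  have hran0 : (Φ' x₀).range = ⊤ := by
    rw [LinearMap.range_eq_top]
    rintro ⟨r, k⟩
    obtain ⟨e, he⟩ := LinearMap.range_eq_top.mp hsurj r
    have he : A e = r := he
    refine ⟨e + ((k - s e : A.ker) : E), Prod.ext ?_ ?_⟩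
    · change A (e + ((k - s e : A.ker) : E)) = r
      rw [map_add, he]
      have : A ((k - s e : A.ker) : E) = 0 := (k - s e).2
      rw [this, add_zero]
    · change s (e + ((k - s e : A.ker) : E)) = k
      rw [map_add, hsk]
      abel
  let L : E ≃L[ℝ] R × A.ker := ContinuousLinearEquiv.ofBijective (Φ' x₀) hker0 hran0
  have hLΦ : (L : E →L[ℝ] R × A.ker) = Φ' x₀ := ContinuousLinearEquiv.coe_ofBijective _ _ _
  have hL : HasFDerivAt Φ (L : E →L[ℝ] R × A.ker) x₀ := by
    rw [hLΦ]; exact hΦ' x₀ hf.self_of_nhds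
  let P := hΦC.toOpenPartialHomeomorph Φ hL (by simp)
  have hx₀ : x₀ ∈ P.source := hΦC.mem_toOpenPartialHomeomorph_source hL (by simp)
  have hinv : ∀ᶠ x in 𝓝 x₀, ∃ L' : E ≃L[ℝ] R × A.ker, (L' : E →L[ℝ] R × A.ker) = Φ' x := by
    have hc : ContinuousAt Φ' x₀ := by
      have h1 : ContinuousAt (fderiv ℝ f) x₀ :=
        (hf.self_of_nhds.fderiv_right (m := 0) (by simp)).continuousAt
      have h2 : Φ' = fun x => (ContinuousLinearMap.inl ℝ R A.ker).comp (q.comp (fderiv ℝ f x)) +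
          (ContinuousLinearMap.inr ℝ R A.ker).comp S := by
        funext x; ext w <;> simp [Φ']
      rw [h2]
      exact (continuousAt_const.clm_comp (continuousAt_const.clm_comp h1)).add continuousAt_const
    have h3 := ContinuousLinearEquiv.nhds L
    rw [hLΦ] at h3
    exact hc h3
  have hgood : ∀ᶠ x in 𝓝 x₀, ContDiffAt ℝ 1 f x ∧
      (∀ w, q (fderiv ℝ f x w) = 0 → fderiv ℝ f x w = 0) ∧
      ∃ L' : E ≃L[ℝ] R × A.ker, (L' : E →L[ℝ] R × A.ker) = Φ' x := hf.and (hker.and hinv)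
  have hgood' : ∀ᶠ u in 𝓝 (P x₀), u ∈ P.target ∧ (ContDiffAt ℝ 1 f (P.symm u) ∧
      (∀ w, q (fderiv ℝ f (P.symm u) w) = 0 → fderiv ℝ f (P.symm u) w = 0) ∧
      ∃ L' : E ≃L[ℝ] R × A.ker, (L' : E →L[ℝ] R × A.ker) = Φ' (P.symm u)) := by
    refine Filter.Eventually.and (P.open_target.mem_nhds (P.map_source hx₀)) ?_
    have := P.continuousAt_symm (P.map_source hx₀)
    rw [ContinuousAt, P.left_inv hx₀] at this
    exact this.eventually hgood
  obtain ⟨ε, hε, hball⟩ := Metric.eventually_nhds_iff_ball.mp hgood'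
  have hderiv : ∀ u ∈ Metric.ball (P x₀) ε, ∃ B : R × A.ker →L[ℝ] F,
      HasFDerivAt (f ∘ P.symm) B u ∧ ∀ k : A.ker, B (0, k) = 0 := by
    intro u hu
    obtain ⟨hut, hfu, hku, L', hL'⟩ := hball u hu
    have h1 : HasFDerivAt P (L' : E →L[ℝ] R × A.ker) (P.symm u) := by
      rw [hL']; exact hΦ' _ hfu
    have h2 := P.hasFDerivAt_symm hut h1
    refine ⟨_, ((hfu.differentiableAt (by simp)).hasFDerivAt).comp u h2, fun k => ?_⟩
    apply hku
    have h3 : Φ' (P.symm u) (L'.symm (0, k)) = (0, k) := by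
      rw [← hL']; simp
    exact congrArg Prod.fst h3
  -- The ball is convex, so the segment from `u` to `v` stays in it and runs in the `A.ker`
  -- direction, where the derivative of `f ∘ P.symm` is zero.
  have hconst : ∀ u ∈ Metric.ball (P x₀) ε, ∀ v ∈ Metric.ball (P x₀) ε, u.1 = v.1 →
      f (P.symm u) = f (P.symm v) := by
    intro u hu v hv huv
    have hseg : ∀ t ∈ Set.Icc (0 : ℝ) 1, u + t • (v - u) ∈ Metric.ball (P x₀) ε := fun t ht =>
      (convex_ball _ _).add_smul_sub_mem hu hv ht
    have hd : ∀ t ∈ Set.Icc (0 : ℝ) 1,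
        HasDerivAt (fun t : ℝ => f (P.symm (u + t • (v - u)))) 0 t := by
      intro t ht
      obtain ⟨B, hB, hB0⟩ := hderiv _ (hseg t ht)
      have h1 : HasDerivAt (fun t : ℝ => u + t • (v - u)) (v - u) t := by
        simpa using ((hasDerivAt_id t).smul_const (v - u)).const_add u
      have h2 := hB.comp_hasDerivAt t h1
      have h3 : v - u = (0, v.2 - u.2) := by
        ext
        · simp [huv]
        · simp
      rw [h3, hB0] at h2
      rw [h3]
      exact h2
    have := constant_of_has_deriv_right_zero (f := fun t : ℝ => f (P.symm (u + t • (v - u))))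
      (a := 0) (b := 1) (fun t ht => (hd t ht).continuousAt.continuousWithinAt)
      (fun t ht => (hd t ⟨ht.1, ht.2.le⟩).hasDerivWithinAt) 1 (by simp)
    simpa using this.symm
  refine ⟨P.source ∩ P ⁻¹' Metric.ball (P x₀) ε, Filter.inter_mem (P.open_source.mem_nhds hx₀)
    (P.continuousAt hx₀ (Metric.ball_mem_nhds _ hε)), fun x hx y hy hxy => ?_⟩
  have := hconst _ hx.2 _ hy.2 hxy
  rwa [P.left_inv hx.1, P.left_inv hy.1] at this

/-- A continuously differentiable open map between finite-dimensional spaces is a submersion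
at some point. -/
theorem exists_range_fderiv_eq_top_of_isOpenMap {E F : Type*} [NormedAddCommGroup E]
    [NormedSpace ℝ E] [FiniteDimensional ℝ E] [NormedAddCommGroup F] [NormedSpace ℝ F]
    [FiniteDimensional ℝ F] {f : E → F} {U : Set E} (hU : IsOpen U) (hne : U.Nonempty)
    (hf : ContDiffOn ℝ 1 f U) (hopen : ∀ x ∈ U, ∀ V ∈ 𝓝 x, f '' V ∈ 𝓝 (f x)) :
    ∃ x ∈ U, (fderiv ℝ f x).range = ⊤ := by
  have hmax : ∃ x ∈ U, ∀ y ∈ U, Module.finrank ℝ (fderiv ℝ f y).range ≤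
      Module.finrank ℝ (fderiv ℝ f x).range := by
    have hbdd : ((fun x => Module.finrank ℝ (fderiv ℝ f x).range) '' U).Finite :=
      (Set.finite_Iic (Module.finrank ℝ F)).subset (by
        rintro _ ⟨x, -, rfl⟩
        exact Submodule.finrank_le _)
    obtain ⟨_, ⟨x, hx, rfl⟩, hm⟩ := hbdd.exists_maximal (hne.image _)
    refine ⟨x, hx, fun y hy => ?_⟩
    by_contra! hlt
    exact absurd (hm ⟨y, hy, rfl⟩ hlt.le) (not_le.mpr hlt)
  obtain ⟨x₀, hx₀, hmax⟩ := hmax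
  refine ⟨x₀, hx₀, ?_⟩
  set R := (fderiv ℝ f x₀).range with hR
  obtain ⟨q₀, hq₀⟩ := R.subtype.exists_leftInverse_of_injective R.ker_subtype
  let q : F →L[ℝ] R := LinearMap.toContinuousLinearMap q₀
  have hq : ∀ r : R, q r = r := fun r => LinearMap.congr_fun hq₀ r
  have hC : ∀ x ∈ U, ContDiffAt ℝ 1 f x := fun x hx => hf.contDiffAt (hU.mem_nhds hx)
  have hsurj : (q.comp (fderiv ℝ f x₀)).range = ⊤ := by
    rw [LinearMap.range_eq_top]
    rintro ⟨_, ⟨w, rfl⟩⟩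
    exact ⟨w, hq ⟨_, ⟨w, rfl⟩⟩⟩
  have hsurj' : ∀ᶠ x in 𝓝 x₀, (q.comp (fderiv ℝ f x)).range = ⊤ := by
    obtain ⟨s, hs⟩ := (q.comp (fderiv ℝ f x₀)).toLinearMap.exists_rightInverse_of_surjective hsurj
    let S : R →L[ℝ] E := LinearMap.toContinuousLinearMap s
    have hc : ContinuousAt (fun x => (q.comp (fderiv ℝ f x)).comp S) x₀ := by
      have h1 : ContinuousAt (fderiv ℝ f) x₀ :=
        ((hC x₀ hx₀).fderiv_right (m := 0) (by simp)).continuousAt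
      exact (continuousAt_const.clm_comp h1).clm_comp continuousAt_const
    have h1 : (q.comp (fderiv ℝ f x₀)).comp S = ContinuousLinearEquiv.refl ℝ R := by
      ext1 r
      exact LinearMap.congr_fun hs r
    have h2 := ContinuousLinearEquiv.nhds (ContinuousLinearEquiv.refl ℝ R)
    rw [← h1] at h2
    filter_upwards [hc h2] with x ⟨e, he⟩
    rw [LinearMap.range_eq_top]
    intro r
    refine ⟨S (e.symm r), ?_⟩
    have := congrArg (fun T : R →L[ℝ] R => T (e.symm r)) he
    simpa using this.symm
  -- Near `x₀` the map `q` still sends the range of the derivative onto `R`; maximality of the rank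
  -- at `x₀` forces equal dimensions, so `q` is injective on that range.
  have hker : ∀ᶠ x in 𝓝 x₀, ∀ w, q (fderiv ℝ f x w) = 0 → fderiv ℝ f x w = 0 := by
    filter_upwards [hsurj', hU.mem_nhds hx₀] with x hx hxU w hw
    let T : (fderiv ℝ f x).range →ₗ[ℝ] R := q.toLinearMap.comp (Submodule.subtype _)
    have hTs : Function.Surjective T := by
      intro r
      obtain ⟨w, hw⟩ := LinearMap.range_eq_top.mp hx r
      exact ⟨⟨_, ⟨w, rfl⟩⟩, hw⟩
    have hTf : Module.finrank ℝ (fderiv ℝ f x).range = Module.finrank ℝ R :=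
      le_antisymm (hmax x hxU) (LinearMap.finrank_le_finrank_of_surjective hTs)
    have hTi : Function.Injective T :=
      (LinearMap.injective_iff_surjective_of_finrank_eq_finrank hTf).mpr hTs
    have h1 : T ⟨fderiv ℝ f x w, ⟨w, rfl⟩⟩ = T 0 := by
      rw [map_zero]; exact hw
    exact congrArg Subtype.val (hTi h1)
  obtain ⟨V, hV, hVeq⟩ := exists_nhds_forall_eq_of_ker_le
    (Filter.Eventually.mono (hU.mem_nhds hx₀) hC) hker hsurj
  have himg := hopen x₀ hx₀ V hV
  -- By openness `f x₀ + t • k` is a value of `f` on `V` for some `t ≠ 0`. It has the same image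
  -- under `q` as `f x₀`, hence equals it. Thus `q` is injective and `R` is everything.
  have hqker : ∀ k : F, q k = 0 → k = 0 := by
    intro k hk
    have h1 : Filter.Tendsto (fun t : ℝ => f x₀ + t • k) (𝓝[≠] 0) (𝓝 (f x₀)) := by
      have : Continuous fun t : ℝ => f x₀ + t • k := by fun_prop
      have h := this.tendsto 0
      simp only [zero_smul, add_zero] at h
      exact h.mono_left nhdsWithin_le_nhds
    obtain ⟨t, ⟨x, hxV, hx⟩, ht⟩ := ((h1.eventually himg).and self_mem_nhdsWithin).exists
    have h2 : f x = f x₀ := hVeq x hxV x₀ (mem_of_mem_nhds hV) (by rw [hx]; simp [hk])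
    rw [h2] at hx
    have h3 : t • k = 0 := by simpa using hx.symm
    exact (smul_eq_zero.mp h3).resolve_left ht
  rw [eq_top_iff]
  intro y _
  have h1 : y - (q y : F) = 0 := hqker _ (by rw [map_sub, hq, sub_self])
  rw [sub_eq_zero.mp h1]
  exact (q y).2

end OpenMaps

/-! ### Smooth local sections of open homomorphisms -/

section LocalSections

open Topology

/-- A smooth map into a normed space that is the identity near a point and takes values in
a given neighborhood of the point. -/
theorem exists_contDiff_eventuallyEq_id {E : Type*} [NormedAddCommGroup E] [NormedSpace ℝ E]
    [FiniteDimensional ℝ E] {e₀ : E} {W : Set E} (hW : W ∈ 𝓝 e₀) :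
    ∃ ρ : E → E, ContDiff ℝ ∞ ρ ∧ (∀ᶠ e in 𝓝 e₀, ρ e = e) ∧ ∀ e, ρ e ∈ W := by
  obtain ⟨ε, hε, hball⟩ := Metric.mem_nhds_iff.mp hW
  let χ : ContDiffBump e₀ := ⟨ε / 4, ε / 2, by positivity, by linarith⟩
  refine ⟨fun e => e₀ + χ e • (e - e₀), ?_, ?_, fun e => hball ?_⟩
  · exact contDiff_const.add (χ.contDiff.smul (contDiff_id.sub contDiff_const))
  · filter_upwards [χ.eventuallyEq_one] with e he
    simp [he]
  · rw [Metric.mem_ball, dist_eq_norm, add_sub_cancel_left, norm_smul, Real.norm_eq_abs,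
      abs_of_nonneg χ.nonneg]
    by_cases he : e ∈ Metric.ball e₀ (ε / 2)
    · rw [mem_ball_iff_norm] at he
      have := mul_le_mul_of_nonneg_right (χ.le_one (x := e)) (norm_nonneg (e - e₀))
      linarith
    · have : χ e = 0 := by
        rw [← Function.notMem_support, χ.support_eq]
        exact he
      rw [this, zero_mul]
      exact hε

/-- A smooth map with surjective derivative at a point has a smooth local right inverse through
that point. -/
theorem exists_smooth_rightInverse {E F : Type*} [NormedAddCommGroup E] [NormedSpace ℝ E]
    [FiniteDimensional ℝ E] [NormedAddCommGroup F] [NormedSpace ℝ F] [FiniteDimensional ℝ F]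
    {f : E → F} {U : Set E} (hU : IsOpen U) (hf : ContDiffOn ℝ ∞ f U) {x₀ : E} (hx₀ : x₀ ∈ U)
    (hsurj : (fderiv ℝ f x₀).range = ⊤) :
    ∃ σ : F → E, σ (f x₀) = x₀ ∧
      ∀ᶠ e in 𝓝 (f x₀), ContDiffAt ℝ ∞ σ e ∧ σ e ∈ U ∧ f (σ e) = e := by
  obtain ⟨s, hs⟩ := (fderiv ℝ f x₀).toLinearMap.exists_rightInverse_of_surjective hsurj
  let S : F →L[ℝ] E := LinearMap.toContinuousLinearMap s
  let ι : F → E := fun e => x₀ + S e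
  have hι : ContDiff ℝ ∞ ι := contDiff_const.add S.contDiff
  have hι0 : ι 0 = x₀ := by simp [ι]
  -- Restricted to the affine slice `ι`, `f` has identity derivative at `0`; the right inverse is
  -- `ι` after the local inverse of `ψ`.
  let ψ : F → F := f ∘ ι
  have hC : ∀ x ∈ U, ContDiffAt ℝ ∞ f x := fun x hx => hf.contDiffAt (hU.mem_nhds hx)
  have hψ : ∀ e, ι e ∈ U → ContDiffAt ℝ ∞ ψ e := fun e he => (hC _ he).comp e hι.contDiffAt
  have hιU : ι 0 ∈ U := by rwa [hι0]
  have hψ' : HasFDerivAt ψ (ContinuousLinearEquiv.refl ℝ F : F →L[ℝ] F) 0 := by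
    have h1 : HasFDerivAt f (fderiv ℝ f x₀) (ι 0) := by
      rw [hι0]
      exact ((hC x₀ hx₀).differentiableAt (by simp)).hasFDerivAt
    have h2 : HasFDerivAt ι S 0 := S.hasFDerivAt.const_add x₀
    convert h1.comp 0 h2 using 1
    ext r
    exact (LinearMap.congr_fun hs r).symm
  let P := (hψ 0 hιU).toOpenPartialHomeomorph ψ hψ' (by simp)
  have hP : ∀ x, P x = ψ x := fun x => rfl
  have h0 : (0 : F) ∈ P.source :=
    (hψ 0 hιU).mem_toOpenPartialHomeomorph_source hψ' (by simp)
  have hP0 : P 0 = f x₀ := by rw [hP]; simp only [ψ, Function.comp, hι0]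
  have hgood : ∀ᶠ e in 𝓝 (0 : F), ι e ∈ U ∧
      ∃ L : F ≃L[ℝ] F, (L : F →L[ℝ] F) = fderiv ℝ ψ e := by
    refine Filter.Eventually.and
      (hι.continuous.continuousAt (hU.mem_nhds hιU)) ?_
    have hc : ContinuousAt (fderiv ℝ ψ) 0 :=
      ((hψ 0 hιU).fderiv_right (m := 0) (by simp)).continuousAt
    have h3 := ContinuousLinearEquiv.nhds (ContinuousLinearEquiv.refl ℝ F)
    rw [← hψ'.fderiv] at h3
    exact hc h3
  refine ⟨fun e => ι (P.symm e), ?_, ?_⟩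
  · simp only [← hP0, P.left_inv h0, hι0]
  · rw [← hP0]
    have h1 := P.continuousAt_symm (P.map_source h0)
    rw [ContinuousAt, P.left_inv h0] at h1
    filter_upwards [h1.eventually hgood, P.open_target.mem_nhds (P.map_source h0)]
      with e ⟨heU, L, hL⟩ het
    refine ⟨?_, heU, ?_⟩
    · refine hι.contDiffAt.comp e (P.contDiffAt_symm het (f₀' := L) ?_ (hψ _ heU))
      rw [hL]
      exact ((hψ _ heU).differentiableAt (by simp)).hasFDerivAt
    · exact P.right_inv het

/-- A smooth open homomorphism of Lie groups admits smooth local sections. -/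
theorem exists_smooth_local_section {E : Type*} [NormedAddCommGroup E] [NormedSpace ℝ E]
    [FiniteDimensional ℝ E] {G : Type*} [Group G] [TopologicalSpace G] [ChartedSpace E G]
    [LieGroup 𝓘(ℝ, E) ∞ G] {E₁ : Type*} [NormedAddCommGroup E₁] [NormedSpace ℝ E₁]
    [FiniteDimensional ℝ E₁] {G₁ : Type*} [Group G₁] [TopologicalSpace G₁] [ChartedSpace E₁ G₁]
    [LieGroup 𝓘(ℝ, E₁) ∞ G₁] (p : G →* G₁) (hp : ContMDiff 𝓘(ℝ, E) 𝓘(ℝ, E₁) ∞ p)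
    (hopen : IsOpenMap p) :
    ∃ (θ : G₁ → E₁) (c : E₁ → G), ContMDiffAt 𝓘(ℝ, E₁) 𝓘(ℝ, E₁) ∞ θ 1 ∧
      ContMDiff 𝓘(ℝ, E₁) 𝓘(ℝ, E) ∞ c ∧ (∀ᶠ z in 𝓝 (1 : G₁), p (c (θ z)) = z) ∧
      c (θ 1) = 1 := by
  have : IsManifold 𝓘(ℝ, E) ∞ G := LieGroup.toContMDiffMul.toIsManifold
  have : IsManifold 𝓘(ℝ, E₁) ∞ G₁ := LieGroup.toContMDiffMul.toIsManifold
  let φ := chartAt E (1 : G)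
  let φ₁ := chartAt E₁ (1 : G₁)
  have hφs : ContMDiffOn 𝓘(ℝ, E) 𝓘(ℝ, E) ∞ φ.symm φ.target := contMDiffOn_chart_symm
  have hφ₁ : ContMDiffOn 𝓘(ℝ, E₁) 𝓘(ℝ, E₁) ∞ φ₁ φ₁.source := contMDiffOn_chart
  let f : E → E₁ := fun x => φ₁ (p (φ.symm x))
  let U : Set E := φ.target ∩ φ.symm ⁻¹' (p ⁻¹' φ₁.source)
  have hU : IsOpen U := φ.symm.isOpen_inter_preimage (φ₁.open_source.preimage hp.continuous)
  have hne : U.Nonempty := by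
    refine ⟨φ 1, φ.map_source (mem_chart_source E 1), ?_⟩
    simp only [Set.mem_preimage]
    rw [φ.left_inv (mem_chart_source E 1), map_one]
    exact mem_chart_source E₁ 1
  have hf : ContDiffOn ℝ ∞ f U := by
    rw [← contMDiffOn_iff_contDiffOn]
    refine hφ₁.comp (hp.comp_contMDiffOn (hφs.mono Set.inter_subset_left)) ?_
    exact fun x hx => hx.2
  have hfo : ∀ x ∈ U, ∀ V ∈ 𝓝 x, f '' V ∈ 𝓝 (f x) := by
    intro x hx V hV
    have h1 : Filter.map φ.symm (𝓝 x) = 𝓝 (φ.symm x) := φ.symm.map_nhds_eq hx.1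
    have h2 : 𝓝 (p (φ.symm x)) ≤ Filter.map p (𝓝 (φ.symm x)) := hopen.nhds_le _
    have h3 : Filter.map φ₁ (𝓝 (p (φ.symm x))) = 𝓝 (φ₁ (p (φ.symm x))) := φ₁.map_nhds_eq hx.2
    have h4 : 𝓝 (f x) ≤ Filter.map f (𝓝 x) := by
      have : Filter.map f (𝓝 x) = Filter.map φ₁ (Filter.map p (Filter.map φ.symm (𝓝 x))) := rfl
      rw [this, h1]
      exact h3 ▸ Filter.map_mono h2
    exact h4 (Filter.image_mem_map hV)
  obtain ⟨x₀, hx₀, hsurj⟩ := exists_range_fderiv_eq_top_of_isOpenMap hU hne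
    (hf.of_le (by simp)) hfo
  obtain ⟨σ, hσ0, hσ⟩ := exists_smooth_rightInverse hU hf hx₀ hsurj
  -- The cutoff `ρ` makes the section smooth on all of `E₁`. The submersion point `g₀` need not be
  -- the identity, so the section is built near `p g₀` and multiplied on the right by `g₀⁻¹`.
  obtain ⟨ρ, hρ, hρid, hρW⟩ := exists_contDiff_eventuallyEq_id hσ
  let g₀ : G := φ.symm x₀
  have hθ1 : φ₁ (1 * p g₀) = f x₀ := by rw [one_mul]
  have hcont : ContMDiffAt 𝓘(ℝ, E₁) 𝓘(ℝ, E₁) ∞ (fun z : G₁ => φ₁ (z * p g₀)) 1 := by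
    refine ContMDiffAt.comp (I' := 𝓘(ℝ, E₁)) 1 (g := φ₁) (f := fun z : G₁ => z * p g₀)
      (hφ₁.contMDiffAt (φ₁.open_source.mem_nhds ?_)) contMDiff_mul_right.contMDiffAt
    rw [one_mul]
    exact hx₀.2
  refine ⟨fun z => φ₁ (z * p g₀), fun e => φ.symm (σ (ρ e)) * g₀⁻¹, hcont, ?_, ?_, ?_⟩
  · have h1 : ContMDiff 𝓘(ℝ, E₁) 𝓘(ℝ, E) ∞ fun e => σ (ρ e) := by
      rw [contMDiff_iff_contDiff, contDiff_iff_contDiffAt]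
      exact fun e => (hρW e).1.comp e hρ.contDiffAt
    exact contMDiff_mul_right.comp (hφs.comp_contMDiff h1 fun e => (hρW e).2.1.1)
  · have h1 := hcont.continuousAt
    rw [ContinuousAt, hθ1] at h1
    have h2 : Filter.Tendsto (fun z : G₁ => z * p g₀) (𝓝 1) (𝓝 (p g₀)) := by
      have : Continuous fun z : G₁ => z * p g₀ :=
        (contMDiff_mul_right (I := 𝓘(ℝ, E₁)) (n := ∞)).continuous
      simpa using this.tendsto 1
    filter_upwards [h1.eventually (hρid.and hσ), h2 (φ₁.open_source.mem_nhds hx₀.2)]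
      with z ⟨hz1, hz2, hz3, hz4⟩ hz5
    have h3 : p (φ.symm (σ (φ₁ (z * p g₀)))) = z * p g₀ := φ₁.injOn hz3.2 hz5 hz4
    simp only [hz1, map_mul, map_inv, h3, mul_inv_cancel_right]
  · simp only [hθ1, hρid.self_of_nhds, hσ0]
    exact mul_inv_cancel _

end LocalSections

/-! ### Topology of Lie groups and measures on the fibre -/

section FiberMeasures

open MeasureTheory Topology
open scoped Pointwise

/-- A compact neighbourhood of `1` generates an open, hence closed, subgroup, which is the whole
group by connectedness; the powers of the symmetrized neighbourhood exhaust it. -/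
theorem sigmaCompactSpace_of_connected (G : Type*) [Group G] [TopologicalSpace G]
    [IsTopologicalGroup G] [LocallyCompactSpace G] [ConnectedSpace G] : SigmaCompactSpace G := by
  obtain ⟨K, hK, hK1⟩ := exists_compact_mem_nhds (1 : G)
  let L : Set G := K ∪ K⁻¹
  have hL : IsCompact L := hK.union hK.inv
  have hLinv : L⁻¹ = L := by simp [L, Set.union_comm]
  have hopen : IsOpen (Subgroup.closure K : Set G) :=
    Subgroup.isOpen_of_mem_nhds _ (Filter.mem_of_superset hK1 Subgroup.subset_closure)
  have htop : (Subgroup.closure K : Set G) = Set.univ :=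
    IsClopen.eq_univ ⟨Subgroup.isClosed_of_isOpen _ hopen, hopen⟩ ⟨1, one_mem _⟩
  have hpow : ∀ n : ℕ, IsCompact (L ^ n) := fun n => by
    induction n with
    | zero => rw [pow_zero]; exact isCompact_singleton
    | succ n ih => rw [pow_succ]; exact ih.mul hL
  refine ⟨⟨fun n => L ^ n, hpow, ?_⟩⟩
  rw [Set.eq_univ_iff_forall]
  intro x
  have hx : x ∈ Subgroup.closure K := by
    rw [← SetLike.mem_coe, htop]; trivial
  rw [Set.mem_iUnion]
  induction hx using Subgroup.closure_induction with
  | mem x hx => exact ⟨1, by rw [pow_one]; exact Or.inl hx⟩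
  | one => exact ⟨0, by simp⟩
  | mul x y _ _ hx hy =>
    obtain ⟨n, hn⟩ := hx
    obtain ⟨m, hm⟩ := hy
    exact ⟨n + m, by rw [pow_add]; exact Set.mul_mem_mul hn hm⟩
  | inv x _ hx =>
    obtain ⟨n, hn⟩ := hx
    exact ⟨n, by rw [← hLinv, inv_pow]; exact Set.inv_mem_inv.mpr hn⟩

theorem exists_isCompact_subset_image {A B : Type*} [TopologicalSpace A] [TopologicalSpace B]
    [LocallyCompactSpace A] {q : A → B} (hq : IsOpenMap q) (hs : Function.Surjective q)
    {K : Set B} (hK : IsCompact K) : ∃ L : Set A, IsCompact L ∧ K ⊆ q '' L := by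
  choose s hs using hs
  choose N hN hN1 using fun a : A => exists_compact_mem_nhds a
  obtain ⟨t, -, ht⟩ := hK.elim_nhds_subcover (fun b => q '' N (s b)) fun b _ => by
    have := hq.image_mem_nhds (hN1 (s b))
    rwa [hs] at this
  refine ⟨⋃ b ∈ t, N (s b), t.isCompact_biUnion fun b _ => hN _, ht.trans ?_⟩
  rw [Set.image_iUnion₂]

section LieGroupTopology

variable (E : Type*) [NormedAddCommGroup E] [NormedSpace ℝ E] [FiniteDimensional ℝ E]
  (G : Type*) [Group G] [TopologicalSpace G] [ChartedSpace E G] [LieGroup 𝓘(ℝ, E) ∞ G]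

include E in
theorem LieGroup.t2Space : T2Space G := by
  have : IsTopologicalGroup G := topologicalGroup_of_lieGroup 𝓘(ℝ, E) ∞
  have : T1Space G := ChartedSpace.t1Space E G
  infer_instance

include E in
theorem LieGroup.locallyCompactSpace : LocallyCompactSpace G :=
  ChartedSpace.locallyCompactSpace E G

include E in
theorem LieGroup.sigmaCompactSpace [ConnectedSpace G] : SigmaCompactSpace G := by
  have : IsTopologicalGroup G := topologicalGroup_of_lieGroup 𝓘(ℝ, E) ∞
  have := LieGroup.locallyCompactSpace E G
  exact sigmaCompactSpace_of_connected G

end LieGroupTopology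

namespace HomogeneousFlow

section Quotients

variable {𝕜 : Type*} [RCLike 𝕜]
  {E : Type*} [NormedAddCommGroup E] [NormedSpace ℝ E]
  {G : Type*} [Group G] [TopologicalSpace G] [ChartedSpace E G] [LieGroup 𝓘(ℝ, E) ∞ G]
  {D : Subgroup G}
  {G₁ : Type*} [Group G₁] {D₁ : Subgroup G₁}

theorem continuous_testFunction (f : testFunctions 𝕜 E D) : Continuous f.1 :=
  isQuotientMap_quotient_mk'.continuous_iff.mpr f.2.1.continuous

/-- The translates of a test function by the elements of a smooth family in the group. -/
theorem isSmoothFamily_translate [IsTopologicalGroup G] {V : Type*} [NormedAddCommGroup V]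
    [NormedSpace ℝ V] [FiniteDimensional ℝ V] {c : V → G} (hc : ContMDiff 𝓘(ℝ, V) 𝓘(ℝ, E) ∞ c)
    (g : G) (f : testFunctions 𝕜 E D) :
    IsSmoothFamily (E := E) (QuotientGroup.mk : G → G ⧸ D) fun e x => f.1 (c e • g • x) where
  smooth := by
    have h1 : ContMDiff (𝓘(ℝ, V).prod 𝓘(ℝ, E)) 𝓘(ℝ, E) ∞ fun r : V × G => c r.1 * (g * r.2) :=
      (hc.comp contMDiff_fst).mul (contMDiff_mul_left.comp contMDiff_snd)
    exact f.2.1.comp h1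
  support e := by
    obtain ⟨B, hB, hB1⟩ := exists_compact_mem_nhds e
    refine ⟨(fun r : G × (G ⧸ D) => g⁻¹ • r.1⁻¹ • r.2) '' ((c '' B) ×ˢ tsupport f.1),
      ((hB.image hc.continuous).prod f.2.2).image (by fun_prop), ?_⟩
    filter_upwards [hB1] with e' he' x hx
    by_contra hne
    refine hx ⟨(c e', c e' • g • x), ⟨⟨e', he', rfl⟩, subset_tsupport _ hne⟩, ?_⟩
    simp

/-- The map `G ⧸ D → G₁ ⧸ D₁` induced by a homomorphism. -/
def quotientMap (p : G →* G₁) (hpD : D ≤ D₁.comap p) : G ⧸ D → G₁ ⧸ D₁ :=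
  Quotient.map' p fun a b h => by
    rw [QuotientGroup.leftRel_apply] at h ⊢
    rw [← map_inv, ← map_mul]
    exact hpD h

theorem quotientMap_smul (p : G →* G₁) (hpD : D ≤ D₁.comap p) (g : G) (x : G ⧸ D) :
    quotientMap p hpD (g • x) = p g • quotientMap p hpD x := by
  induction x using QuotientGroup.induction_on with
  | H y =>
    change ((p (g * y) : G₁) : G₁ ⧸ D₁) = ((p g * p y : G₁) : G₁ ⧸ D₁)
    rw [map_mul]

theorem continuous_quotientMap [TopologicalSpace G₁] (p : G →* G₁) (hp : Continuous p)
    (hpD : D ≤ D₁.comap p) : Continuous (quotientMap p hpD) :=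
  hp.quotient_map' _

/-- A probability measure on the fibre of `G ⧸ D → G₁ ⧸ D₁` over the base point, invariant under
the stabilizer of the base point. -/
structure IsFiberMeasure [MeasurableSpace (G ⧸ D)] (p : G →* G₁) (hpD : D ≤ D₁.comap p)
    (l : Measure (G ⧸ D)) : Prop where
  isProbabilityMeasure : IsProbabilityMeasure l
  ae_eq : ∀ᵐ x ∂l, quotientMap p hpD x = ((1 : G₁) : G₁ ⧸ D₁)
  map_smul : ∀ g : G, p g ∈ D₁ → l.map (g • ·) = l

/-- The integrals of a function along the fibres of `G ⧸ D → G₁ ⧸ D₁`. -/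
noncomputable def fiberIntegral [MeasurableSpace (G ⧸ D)] (p : G →* G₁) (D₁ : Subgroup G₁)
    (l : Measure (G ⧸ D)) (f : G ⧸ D → 𝕜) (y : G₁ ⧸ D₁) : 𝕜 :=
  ∫ x, f (Classical.epsilon (fun g : G => (p g : G₁ ⧸ D₁) = y) • x) ∂l

variable [MeasurableSpace (G ⧸ D)] [BorelSpace (G ⧸ D)] {p : G →* G₁} {hpD : D ≤ D₁.comap p}
  {l : Measure (G ⧸ D)}

/-- Two lifts of the same point differ by right multiplication by an element of `p⁻¹(D₁)`, which
preserves `l`; the arbitrary choice in `fiberIntegral` is therefore harmless. -/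
theorem fiberIntegral_mk [IsTopologicalGroup G] (hl : IsFiberMeasure p hpD l)
    (f : testFunctions 𝕜 E D) (g : G) :
    fiberIntegral p D₁ l f.1 (p g : G₁ ⧸ D₁) = ∫ x, f.1 (g • x) ∂l := by
  rw [fiberIntegral]
  set g' := Classical.epsilon (fun g' : G => (p g' : G₁ ⧸ D₁) = p g) with hg'
  have h1 : (p g' : G₁ ⧸ D₁) = p g :=
    Classical.epsilon_spec (p := fun g' : G => (p g' : G₁ ⧸ D₁) = p g) ⟨g, rfl⟩
  have h2 : p (g⁻¹ * g') ∈ D₁ := by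
    rw [map_mul, map_inv]
    exact QuotientGroup.eq.mp h1.symm
  have h3 := hl.map_smul _ h2
  conv_rhs => rw [← h3]
  rw [integral_map]
  · simp [mul_smul]
  · exact (continuous_const_smul _).measurable.aemeasurable
  · have : SecondCountableTopologyEither (G ⧸ D) 𝕜 := inferInstance
    exact ((continuous_testFunction f).comp (continuous_const_smul g)).aestronglyMeasurable

end Quotients

end HomogeneousFlow

end FiberMeasures

/-! ### Integration along the fibres and its dual -/

section FiberIntegrals

open MeasureTheory Topology

namespace HomogeneousFlow

section FiberIntegral

variable {𝕜 : Type*} [RCLike 𝕜]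
  {E : Type*} [NormedAddCommGroup E] [NormedSpace ℝ E] [FiniteDimensional ℝ E]
  {G : Type*} [Group G] [TopologicalSpace G] [ChartedSpace E G] [LieGroup 𝓘(ℝ, E) ∞ G]
  [IsTopologicalGroup G]
  {D : Subgroup G} [MeasurableSpace (G ⧸ D)] [BorelSpace (G ⧸ D)] [T2Space (G ⧸ D)]
  {E₁ : Type*} [NormedAddCommGroup E₁] [NormedSpace ℝ E₁] [FiniteDimensional ℝ E₁]
  {G₁ : Type*} [Group G₁] [TopologicalSpace G₁] [ChartedSpace E₁ G₁]
  [LieGroup 𝓘(ℝ, E₁) ∞ G₁] [IsTopologicalGroup G₁] {D₁ : Subgroup G₁} [T2Space (G₁ ⧸ D₁)]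
  {p : G →* G₁} {hpD : D ≤ D₁.comap p} {l : Measure (G ⧸ D)}

/-- Near `p g₀` the lift can be taken as `c (θ (z * (p g₀)⁻¹)) * g₀`, smooth in `z`, which exhibits
the function as a smooth parametric integral composed with `θ`. -/
theorem contMDiff_fiberIntegral (hl : IsFiberMeasure p hpD l)
    (hp : ContMDiff 𝓘(ℝ, E) 𝓘(ℝ, E₁) ∞ p) (hopen : IsOpenMap p)
    (hsurj : Function.Surjective p) (f : testFunctions 𝕜 E D) :
    ContMDiff 𝓘(ℝ, E₁) 𝓘(ℝ, 𝕜) ∞ fun z : G₁ => fiberIntegral p D₁ l f.1 (z : G₁ ⧸ D₁) := by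
  have := hl.isProbabilityMeasure
  have : IsManifold 𝓘(ℝ, E) ∞ G := LieGroup.toContMDiffMul.toIsManifold
  obtain ⟨θ, c, hθ, hc, hcθ, -⟩ := exists_smooth_local_section p hp hopen
  intro z₀
  obtain ⟨g₀, rfl⟩ := hsurj z₀
  have hH := (isSmoothFamily_translate hc g₀ f).contDiff_integral
    QuotientGroup.isOpenQuotientMap_mk l
  have hmul : ContMDiff 𝓘(ℝ, E₁) 𝓘(ℝ, E₁) ∞ fun z : G₁ => z * (p g₀)⁻¹ := contMDiff_mul_right
  have hone : p g₀ * (p g₀)⁻¹ = 1 := mul_inv_cancel _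
  have hθ' : ContMDiffAt 𝓘(ℝ, E₁) 𝓘(ℝ, E₁) ∞ (fun z : G₁ => θ (z * (p g₀)⁻¹)) (p g₀) :=
    ContMDiffAt.comp (I' := 𝓘(ℝ, E₁)) (p g₀) (g := θ) (by rwa [hone]) hmul.contMDiffAt
  refine (hH.contMDiff.contMDiffAt.comp (p g₀) hθ').congr_of_eventuallyEq ?_
  have ht : Filter.Tendsto (fun z : G₁ => z * (p g₀)⁻¹) (𝓝 (p g₀)) (𝓝 1) := by
    have := hmul.continuous.tendsto (p g₀)
    rwa [hone] at this
  filter_upwards [ht.eventually hcθ] with z hz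
  have hz' : z = p (c (θ (z * (p g₀)⁻¹)) * g₀) := by
    rw [map_mul, hz, inv_mul_cancel_right]
  conv_lhs => rw [hz', fiberIntegral_mk hl]
  simp only [Function.comp, mul_smul]

theorem support_fiberIntegral_subset (hl : IsFiberMeasure p hpD l)
    (hsurj : Function.Surjective p) (f : testFunctions 𝕜 E D) :
    Function.support (fiberIntegral p D₁ l f.1) ⊆ quotientMap p hpD '' tsupport f.1 := by
  intro y hy
  induction y using QuotientGroup.induction_on with
  | H z =>
  obtain ⟨g, rfl⟩ := hsurj z
  rw [Function.mem_support, fiberIntegral_mk hl] at hy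
  by_contra hne
  refine hy (integral_eq_zero_of_ae ?_)
  filter_upwards [hl.ae_eq] with x hx
  by_contra hfx
  refine hne ⟨g • x, subset_tsupport _ hfx, ?_⟩
  rw [quotientMap_smul, hx]
  change ((p g * 1 : G₁) : G₁ ⧸ D₁) = _
  rw [mul_one]

theorem tsupport_fiberIntegral_subset (hl : IsFiberMeasure p hpD l) (hp : Continuous p)
    (hsurj : Function.Surjective p) (f : testFunctions 𝕜 E D) :
    tsupport (fiberIntegral p D₁ l f.1) ⊆ quotientMap p hpD '' tsupport f.1 :=
  closure_minimal (support_fiberIntegral_subset hl hsurj f)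
    ((f.2.2.image (continuous_quotientMap p hp hpD)).isClosed)

theorem integrable_translate (hl : IsFiberMeasure p hpD l) (f : testFunctions 𝕜 E D) (g : G) :
    Integrable (fun x => f.1 (g • x)) l := by
  have := hl.isProbabilityMeasure
  have : IsManifold 𝓘(ℝ, E) ∞ G := LieGroup.toContMDiffMul.toIsManifold
  have h := (isSmoothFamily_translate (V := ℝ) (c := fun _ => (1 : G))
    contMDiff_const g f).integrable
    QuotientGroup.isOpenQuotientMap_mk l 0
  simpa using h

theorem norm_fiberIntegral_le (hl : IsFiberMeasure p hpD l) (hsurj : Function.Surjective p)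
    (f : testFunctions 𝕜 E D) {B : ℝ} (hB : ∀ x, ‖f.1 x‖ ≤ B) (y : G₁ ⧸ D₁) :
    ‖fiberIntegral p D₁ l f.1 y‖ ≤ B := by
  have := hl.isProbabilityMeasure
  induction y using QuotientGroup.induction_on with
  | H z =>
  obtain ⟨g, rfl⟩ := hsurj z
  rw [fiberIntegral_mk hl]
  simpa using norm_integral_le_of_norm_le_const (μ := l) (C := B)
    (Filter.Eventually.of_forall fun x => hB (g • x))

/-- Integration along the fibres, as a linear map between the spaces of test functions. -/
noncomputable def fiberPush (hl : IsFiberMeasure p hpD l)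
    (hp : ContMDiff 𝓘(ℝ, E) 𝓘(ℝ, E₁) ∞ p) (hopen : IsOpenMap p)
    (hsurj : Function.Surjective p) : testFunctions 𝕜 E D →ₗ[𝕜] testFunctions 𝕜 E₁ D₁ where
  toFun f := ⟨fiberIntegral p D₁ l f.1, contMDiff_fiberIntegral hl hp hopen hsurj f,
    HasCompactSupport.of_support_subset_isCompact
      (f.2.2.image (continuous_quotientMap p hp.continuous hpD))
      (support_fiberIntegral_subset hl hsurj f)⟩
  map_add' f f' := by
    ext y
    induction y using QuotientGroup.induction_on with
    | H z =>
    obtain ⟨g, rfl⟩ := hsurj z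
    change fiberIntegral p D₁ l (f + f').1 _ =
      fiberIntegral p D₁ l f.1 _ + fiberIntegral p D₁ l f'.1 _
    rw [fiberIntegral_mk hl, fiberIntegral_mk hl, fiberIntegral_mk hl]
    exact integral_add (integrable_translate hl f g) (integrable_translate hl f' g)
  map_smul' a f := by
    ext y
    induction y using QuotientGroup.induction_on with
    | H z =>
    obtain ⟨g, rfl⟩ := hsurj z
    change fiberIntegral p D₁ l (a • f).1 _ = a • fiberIntegral p D₁ l f.1 _
    rw [fiberIntegral_mk hl, fiberIntegral_mk hl]
    exact integral_smul a _

variable (hl : IsFiberMeasure p hpD l) (hp : ContMDiff 𝓘(ℝ, E) 𝓘(ℝ, E₁) ∞ p)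
  (hopen : IsOpenMap p) (hsurj : Function.Surjective p)

theorem fiberPush_mk (f : testFunctions 𝕜 E D) (g : G) :
    (fiberPush hl hp hopen hsurj f).1 (p g : G₁ ⧸ D₁) = ∫ x, f.1 (g • x) ∂l :=
  fiberIntegral_mk hl f g

/-- Lifting `γ₁.toFun t * p g` to `γ.toFun t * g` moves the flow inside the integral; the rest is
differentiation under the integral sign. -/
theorem fiberPush_lieDerivative (γ : OneParameterSubgroup E G) (γ₁ : OneParameterSubgroup E₁ G₁)
    (hpγ : ∀ t : ℝ, p (γ.toFun t) = γ₁.toFun t) (f : testFunctions 𝕜 E D) :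
    lieDerivative γ₁ (fiberPush hl hp hopen hsurj f) =
      fiberPush hl hp hopen hsurj (lieDerivative γ f) := by
  have := hl.isProbabilityMeasure
  have : IsManifold 𝓘(ℝ, E) ∞ G := LieGroup.toContMDiffMul.toIsManifold
  ext y
  induction y using QuotientGroup.induction_on with
  | H z =>
  obtain ⟨g, rfl⟩ := hsurj z
  rw [fiberPush_mk]
  have h1 : ∀ t : ℝ, (fiberPush hl hp hopen hsurj f).1 (γ₁.toFun t • (p g : G₁ ⧸ D₁)) =
      ∫ x, f.1 (γ.toFun t • g • x) ∂l := fun t => by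
    have h2 : γ₁.toFun t • (p g : G₁ ⧸ D₁) = (p (γ.toFun t * g) : G₁ ⧸ D₁) := by
      rw [map_mul, hpγ]; rfl
    rw [h2, fiberPush_mk]
    simp only [mul_smul]
  change deriv (fun t : ℝ => (fiberPush hl hp hopen hsurj f).1 (γ₁.toFun t • (p g : G₁ ⧸ D₁))) 0
    = ∫ x, deriv (fun t : ℝ => f.1 (γ.toFun t • g • x)) 0 ∂l
  simp only [h1, ← fderiv_apply_one_eq_deriv]
  exact (isSmoothFamily_translate γ.smooth' g f).fderiv_integral_apply
    QuotientGroup.isOpenQuotientMap_mk l 0 1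

/-- Each derivative of the fibre integral along a vector of the Lie algebra of `G₁` is the
fibre integral of a derivative along a vector of the Lie algebra of `G`. -/
theorem exists_derivAlong_fiberPush (v : GroupLieAlgebra 𝓘(ℝ, E₁) G₁) :
    ∃ u : GroupLieAlgebra 𝓘(ℝ, E) G, ∀ f : testFunctions 𝕜 E D,
      derivAlong v (fiberPush hl hp hopen hsurj f) =
        fiberPush hl hp hopen hsurj (derivAlong u f) := by
  have := hl.isProbabilityMeasure
  have : IsManifold 𝓘(ℝ, E) ∞ G := LieGroup.toContMDiffMul.toIsManifold
  obtain ⟨θ, c, hθ, hc, hcθ, hc1⟩ := exists_smooth_local_section p hp hopen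
  -- The vector `u` is the image of `v` under the derivative at `1` of the local section `c ∘ θ`; it
  -- depends on neither `f` nor the point.
  let w : E₁ := mfderiv 𝓘(ℝ, E₁) 𝓘(ℝ, E₁) θ 1 v
  let u : E := mfderiv 𝓘(ℝ, E₁) 𝓘(ℝ, E) c (θ 1) w
  refine ⟨u, fun f => ?_⟩
  ext y
  induction y using QuotientGroup.induction_on with
  | H z =>
  obtain ⟨g, rfl⟩ := hsurj z
  rw [fiberPush_mk]
  let H : E₁ → 𝕜 := fun e => ∫ x, f.1 (c e • g • x) ∂l
  have hfam := isSmoothFamily_translate hc g f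
  have hH : ContDiff ℝ ∞ H := hfam.contDiff_integral QuotientGroup.isOpenQuotientMap_mk l
  have h1 : (fun z : G₁ => (fiberPush hl hp hopen hsurj f).1 (z • (p g : G₁ ⧸ D₁))) =ᶠ[𝓝 1]
      H ∘ θ := by
    filter_upwards [hcθ] with z hz
    have h2 : z • (p g : G₁ ⧸ D₁) = (p (c (θ z) * g) : G₁ ⧸ D₁) := by
      rw [map_mul, hz]; rfl
    rw [h2, fiberPush_mk]
    simp only [H, Function.comp, mul_smul]
  have h3 : mfderiv 𝓘(ℝ, E₁) 𝓘(ℝ, 𝕜)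
      (fun z : G₁ => (fiberPush hl hp hopen hsurj f).1 (z • (p g : G₁ ⧸ D₁))) 1 v =
      fderiv ℝ H (θ 1) w := by
    rw [h1.mfderiv_eq, mfderiv_comp (I' := 𝓘(ℝ, E₁)) 1
      (hH.contMDiff.mdifferentiable (by simp) (θ 1)) (hθ.mdifferentiableAt (by simp)),
      mfderiv_eq_fderiv]
    rfl
  have h4 : ∀ x : G ⧸ D, fderiv ℝ (fun e => f.1 (c e • g • x)) (θ 1) w =
      mfderiv 𝓘(ℝ, E) 𝓘(ℝ, 𝕜) (fun g' : G => f.1 (g' • g • x)) 1 u := by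
    intro x
    have hF : MDifferentiableAt 𝓘(ℝ, E) 𝓘(ℝ, 𝕜) (fun g' : G => f.1 (g' • g • x)) 1 := by
      generalize g • x = x'
      induction x' using QuotientGroup.induction_on with
      | H b =>
      have : ContMDiff 𝓘(ℝ, E) 𝓘(ℝ, 𝕜) ∞ (fun g' : G => f.1 ((g' * b : G) : G ⧸ D)) :=
        f.2.1.comp contMDiff_mul_right
      exact this.mdifferentiable (by simp) 1
    let A : E →L[ℝ] 𝕜 := mfderiv 𝓘(ℝ, E) 𝓘(ℝ, 𝕜) (fun g' : G => f.1 (g' • g • x)) 1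
    have h5 : HasMFDerivAt 𝓘(ℝ, E) 𝓘(ℝ, 𝕜) (fun g' : G => f.1 (g' • g • x)) (c (θ 1)) A := by
      rw [hc1]
      exact hF.hasMFDerivAt
    have h6 := h5.comp (θ 1) (hc.mdifferentiable (by simp) (θ 1)).hasMFDerivAt
    let B : E₁ →L[ℝ] E := mfderiv 𝓘(ℝ, E₁) 𝓘(ℝ, E) c (θ 1)
    have h7 : HasFDerivAt (fun e => f.1 (c e • g • x)) (A.comp B) (θ 1) :=
      hasMFDerivAt_iff_hasFDerivAt.mp h6
    exact congrArg (fun T : E₁ →L[ℝ] 𝕜 => T w) h7.fderiv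
  have h8 : fderiv ℝ H (θ 1) w =
      ∫ x, (mfderiv 𝓘(ℝ, E) 𝓘(ℝ, 𝕜) (fun g' : G => f.1 (g' • g • x)) 1 u : 𝕜) ∂l := by
    rw [hfam.fderiv_integral_apply QuotientGroup.isOpenQuotientMap_mk l]
    exact integral_congr_ae (Filter.Eventually.of_forall h4)
  exact Eq.trans h3 h8

theorem exists_iteratedDerivAlong_fiberPush (w : List (GroupLieAlgebra 𝓘(ℝ, E₁) G₁)) :
    ∃ u : List (GroupLieAlgebra 𝓘(ℝ, E) G), ∀ f : testFunctions 𝕜 E D,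
      iteratedDerivAlong w (fiberPush hl hp hopen hsurj f) =
        fiberPush hl hp hopen hsurj (iteratedDerivAlong u f) := by
  induction w with
  | nil => exact ⟨[], fun f => rfl⟩
  | cons v w ih =>
    obtain ⟨u, hu⟩ := ih
    obtain ⟨u₀, hu₀⟩ := exists_derivAlong_fiberPush (𝕜 := 𝕜) hl hp hopen hsurj v
    refine ⟨u₀ :: u, fun f => ?_⟩
    change derivAlong v (iteratedDerivAlong w _) = _
    rw [hu, hu₀]
    rfl

/-- The estimate for `T` on the compact image of `K` transfers with the same constant: words of
vectors lift to `G`, and averaging against a probability measure does not increase uniform bounds.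
-/
theorem comp_fiberPush_mem_distributions (T : distributions 𝕜 E₁ D₁) :
    T.1.comp (fiberPush hl hp hopen hsurj) ∈ distributions 𝕜 E D := by
  classical
  intro K hK
  obtain ⟨S, C, hSC⟩ := T.2 _ (hK.image (continuous_quotientMap p hp.continuous hpD))
  choose φ hφ using exists_iteratedDerivAlong_fiberPush (𝕜 := 𝕜) hl hp hopen hsurj
  refine ⟨S.image φ, C, fun f hf B hB => hSC _ ?_ B fun w hw y => ?_⟩
  · exact (tsupport_fiberIntegral_subset hl hp.continuous hsurj f).trans (Set.image_mono hf)
  · rw [hφ]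
    exact norm_fiberIntegral_le hl hsurj _ (hB _ (Finset.mem_image_of_mem φ hw)) y

/-- The pullback of distributions that is dual to the integration along the fibres. -/
noncomputable def distributionsPullback : distributions 𝕜 E₁ D₁ →ₗ[𝕜] distributions 𝕜 E D where
  toFun T := ⟨T.1.comp (fiberPush hl hp hopen hsurj),
    comp_fiberPush_mem_distributions hl hp hopen hsurj T⟩
  map_add' _ _ := rfl
  map_smul' _ _ := rfl

theorem isInvariant_distributionsPullback (γ : OneParameterSubgroup E G)
    (γ₁ : OneParameterSubgroup E₁ G₁) (hpγ : ∀ t : ℝ, p (γ.toFun t) = γ₁.toFun t)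
    {T : distributions 𝕜 E₁ D₁} (hT : IsInvariant γ₁ T) :
    IsInvariant γ (distributionsPullback hl hp hopen hsurj T) := fun f => by
  change T.1 (fiberPush hl hp hopen hsurj (lieDerivative γ f)) = 0
  rw [← fiberPush_lieDerivative hl hp hopen hsurj γ γ₁ hpγ]
  exact hT _

theorem distributionsPullback_injective
    (hP : Function.Surjective (fiberPush (𝕜 := 𝕜) hl hp hopen hsurj)) :
    Function.Injective (distributionsPullback (𝕜 := 𝕜) hl hp hopen hsurj) := by
  intro T T' h
  refine Subtype.ext (LinearMap.ext fun φ => ?_)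
  obtain ⟨f, rfl⟩ := hP φ
  exact LinearMap.congr_fun (congrArg Subtype.val h) f

end FiberIntegral

end HomogeneousFlow

end FiberIntegrals

/-! ### Surjectivity of fibre integration -/

section SurjectivityOfFiberIntegration

open MeasureTheory Topology

namespace HomogeneousFlow

section AveragedBumpFunctions

variable {E : Type*} [NormedAddCommGroup E] [NormedSpace ℝ E] [FiniteDimensional ℝ E]
  {G : Type*} [Group G] [TopologicalSpace G] [ChartedSpace E G] [LieGroup 𝓘(ℝ, E) ∞ G]
  [IsTopologicalGroup G] [T2Space G] [LocallyCompactSpace G]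

/-- The local section of the identity homomorphism serves as a smooth parametrization of `G` near
`1` and reduces the claim to parameters in `E`. -/
theorem contMDiff_integral_mul [MeasurableSpace G] [BorelSpace G] (m : Measure G)
    [IsFiniteMeasureOnCompacts m] {φ : G → ℝ} (hφ : ContMDiff 𝓘(ℝ, E) 𝓘(ℝ, ℝ) ∞ φ)
    (hφc : HasCompactSupport φ) :
    ContMDiff 𝓘(ℝ, E) 𝓘(ℝ, ℝ) ∞ fun g => ∫ a, φ (g * a) ∂m := by
  have : IsManifold 𝓘(ℝ, E) ∞ G := LieGroup.toContMDiffMul.toIsManifold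
  obtain ⟨θ, c, hθ, hc, hcθ, -⟩ := exists_smooth_local_section (MonoidHom.id G)
    (contMDiff_id (I := 𝓘(ℝ, E))) IsOpenMap.id
  intro g₀
  have hfam : IsSmoothFamily (E := E) (id : G → G) fun (e : E) a => φ (c e * g₀ * a) := by
    refine ⟨hφ.comp ((contMDiff_mul_right.comp (hc.comp contMDiff_fst)).mul contMDiff_snd),
      fun e => ?_⟩
    obtain ⟨B, hB, hB1⟩ := exists_compact_mem_nhds e
    refine ⟨(fun r : G × G => g₀⁻¹ * r.1⁻¹ * r.2) '' ((c '' B) ×ˢ tsupport φ),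
      ((hB.image hc.continuous).prod hφc).image (by fun_prop), ?_⟩
    filter_upwards [hB1] with e' he' x hx
    by_contra hne
    refine hx ⟨(c e', c e' * g₀ * x), ⟨⟨e', he', rfl⟩, subset_tsupport _ hne⟩, ?_⟩
    simp [mul_assoc]
  have hH := hfam.contDiff_integral IsOpenQuotientMap.id m
  have hmul : ContMDiff 𝓘(ℝ, E) 𝓘(ℝ, E) ∞ fun z : G => z * g₀⁻¹ := contMDiff_mul_right
  have hone : g₀ * g₀⁻¹ = 1 := mul_inv_cancel _
  have hθ' : ContMDiffAt 𝓘(ℝ, E) 𝓘(ℝ, E) ∞ (fun z : G => θ (z * g₀⁻¹)) g₀ :=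
    ContMDiffAt.comp (I' := 𝓘(ℝ, E)) g₀ (g := θ) (by rwa [hone]) hmul.contMDiffAt
  refine (hH.contMDiff.contMDiffAt.comp g₀ hθ').congr_of_eventuallyEq ?_
  have ht : Filter.Tendsto (fun z : G => z * g₀⁻¹) (𝓝 g₀) (𝓝 1) := by
    have := hmul.continuous.tendsto g₀
    rwa [hone] at this
  filter_upwards [ht.eventually hcθ] with z hz
  have hz : c (θ (z * g₀⁻¹)) = z * g₀⁻¹ := hz
  simp only [Function.comp, hz, inv_mul_cancel_right]

/-- On the quotient of a Lie group by a closed subgroup there are nonnegative smooth functions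
with compact support that are positive on a given compact set: the averages over the subgroup
of such functions on the group. -/
theorem exists_testFunction_pos [SigmaCompactSpace G] (𝕜 : Type*) [RCLike 𝕜] {D : Subgroup G}
    (hD : IsClosed (D : Set G)) {L : Set G} (hL : IsCompact L) :
    ∃ (u : testFunctions 𝕜 E D) (r : G ⧸ D → ℝ), (∀ x, u.1 x = (r x : 𝕜)) ∧ Continuous r ∧
      (∀ x, 0 ≤ r x) ∧ ∀ g ∈ L, 0 < r (g : G ⧸ D) := by
  have : IsManifold 𝓘(ℝ, E) ∞ G := LieGroup.toContMDiffMul.toIsManifold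
  have : T2Space (G ⧸ D) := by
    have := hD
    infer_instance
  obtain ⟨C, hC, hLC⟩ := exists_compact_superset hL
  obtain ⟨φ, hφs, hφ, hφ0⟩ := (isOpen_interior (s := C)).exists_contMDiff_support_eq 𝓘(ℝ, E)
    (n := ⊤)
  have hφ : ContMDiff 𝓘(ℝ, E) 𝓘(ℝ, ℝ) ∞ φ := hφ
  have hφc : HasCompactSupport φ :=
    HasCompactSupport.of_support_subset_isCompact hC (hφs ▸ interior_subset)
  let _ : MeasurableSpace G := borel G
  have : BorelSpace G := ⟨rfl⟩
  have hemb : IsClosedEmbedding ((↑) : D → G) := hD.isClosedEmbedding_subtypeVal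
  have : LocallyCompactSpace D := hemb.locallyCompactSpace
  let ν : Measure D := Measure.haar
  let m : Measure G := ν.map (↑)
  have hm : IsFiniteMeasureOnCompacts m := ⟨fun K hK => by
    rw [Measure.map_apply hemb.continuous.measurable hK.measurableSet]
    exact (hemb.isCompact_preimage hK).measure_lt_top⟩
  have hmφ : ∀ g : G, ∫ a, φ (g * a) ∂m = ∫ d : D, φ (g * d) ∂ν := fun g =>
    hemb.measurableEmbedding.integral_map _
  -- The average descends to `G ⧸ D` by left invariance of the Haar measure of `D`.
  let r : G ⧸ D → ℝ := fun x => Quotient.liftOn' x (fun g => ∫ a, φ (g * a) ∂m) fun g g' h => by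
    rw [QuotientGroup.leftRel_apply] at h
    simp only [hmφ]
    rw [← integral_mul_left_eq_self (fun d : D => φ (g * d)) ⟨_, h⟩]
    simp [← mul_assoc]
  have hr : ∀ g : G, r (g : G ⧸ D) = ∫ d : D, φ (g * d) ∂ν := fun g => hmφ g
  have hrs : ContMDiff 𝓘(ℝ, E) 𝓘(ℝ, ℝ) ∞ fun g : G => r (g : G ⧸ D) :=
    contMDiff_integral_mul m hφ hφc
  have hrc : HasCompactSupport r := by
    refine HasCompactSupport.intro (hC.image QuotientGroup.continuous_mk) fun x hx => ?_
    induction x using QuotientGroup.induction_on with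
    | H g =>
    rw [hr]
    refine integral_eq_zero_of_ae (Filter.Eventually.of_forall fun d => ?_)
    by_contra hne
    have : g * d ∈ interior C := hφs ▸ Function.mem_support.mpr hne
    exact hx ⟨g * d, interior_subset this, by simp⟩
  refine ⟨⟨fun x => (r x : 𝕜), ?_, hrc.comp_left (g := fun t : ℝ => (t : 𝕜)) (by simp)⟩, r,
    fun x => rfl, isQuotientMap_quotient_mk'.continuous_iff.mpr hrs.continuous, fun x => ?_,
    fun g hg => ?_⟩
  · exact (RCLike.ofRealCLM (K := 𝕜)).contMDiff.comp hrs
  · induction x using QuotientGroup.induction_on with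
    | H g =>
    rw [hr]
    exact integral_nonneg fun d => hφ0 _
  · rw [hr]
    refine Continuous.integral_pos_of_hasCompactSupport_nonneg_nonzero (x := (1 : D))
      (hφ.continuous.comp (continuous_const.mul continuous_subtype_val)) ?_
      (fun d => hφ0 _) ?_
    · exact (hφc.comp_homeomorph (Homeomorph.mulLeft g)).comp_isClosedEmbedding hemb
    · have : g ∈ Function.support φ := hφs ▸ hLC hg
      simpa using this

end AveragedBumpFunctions

section Surjectivity

variable {𝕜 : Type*} [RCLike 𝕜]
  {E : Type*} [NormedAddCommGroup E] [NormedSpace ℝ E] [FiniteDimensional ℝ E]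
  {G : Type*} [Group G] [TopologicalSpace G] [ChartedSpace E G] [LieGroup 𝓘(ℝ, E) ∞ G]
  [IsTopologicalGroup G] [T2Space G] [LocallyCompactSpace G] [SigmaCompactSpace G]
  {D : Subgroup G} [MeasurableSpace (G ⧸ D)] [BorelSpace (G ⧸ D)] [T2Space (G ⧸ D)]
  [SecondCountableTopology (G ⧸ D)]
  {E₁ : Type*} [NormedAddCommGroup E₁] [NormedSpace ℝ E₁] [FiniteDimensional ℝ E₁]
  {G₁ : Type*} [Group G₁] [TopologicalSpace G₁] [ChartedSpace E₁ G₁]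
  [LieGroup 𝓘(ℝ, E₁) ∞ G₁] [IsTopologicalGroup G₁] {D₁ : Subgroup G₁} [T2Space (G₁ ⧸ D₁)]
  {p : G →* G₁} {hpD : D ≤ D₁.comap p} {l : Measure (G ⧸ D)}

/-- There are test functions whose fibre integrals vanish nowhere on a given compact set. -/
theorem exists_fiberPush_ne_zero (hD : IsClosed (D : Set G)) (hl : IsFiberMeasure p hpD l)
    (hp : ContMDiff 𝓘(ℝ, E) 𝓘(ℝ, E₁) ∞ p) (hopen : IsOpenMap p)
    (hsurj : Function.Surjective p) {K : Set (G₁ ⧸ D₁)} (hK : IsCompact K) :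
    ∃ u : testFunctions 𝕜 E D, ∀ y ∈ K, (fiberPush hl hp hopen hsurj u).1 y ≠ 0 := by
  have := hl.isProbabilityMeasure
  obtain ⟨L, hL, hKL⟩ := exists_isCompact_subset_image
    (q := fun g : G => (p g : G₁ ⧸ D₁))
    (QuotientGroup.isOpenMap_coe.comp hopen) (QuotientGroup.mk_surjective.comp hsurj) hK
  -- The point `x₀ = g₀ D` lies in the support of `l`. A function positive on the image of `L * g₀`
  -- has, for `g ∈ L`, a translate positive near `x₀`, hence a positive integral.
  obtain ⟨x₀, -, hx₀⟩ := exists_mem_forall_mem_nhdsWithin_pos_measure (μ := l) (s := Set.univ)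
    (by simp)
  simp only [nhdsWithin_univ] at hx₀
  obtain ⟨g₀, rfl⟩ := QuotientGroup.mk_surjective x₀
  obtain ⟨u, r, hur, hrc, hr0, hrL⟩ := exists_testFunction_pos (E := E) 𝕜 hD
    (hL.image (continuous_mul_const g₀))
  refine ⟨u, fun y hy => ?_⟩
  obtain ⟨g, hg, rfl⟩ := hKL hy
  change (fiberPush hl hp hopen hsurj u).1 (p g : G₁ ⧸ D₁) ≠ 0
  rw [fiberPush_mk]
  have h1 := integrable_translate hl u g
  simp only [hur] at h1 ⊢
  rw [integral_ofReal]
  have h2 : Integrable (fun x => r (g • x)) l := by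
    simpa using h1.re
  have hpos : 0 < ∫ x, r (g • x) ∂l := by
    rw [integral_pos_iff_support_of_nonneg (fun x => hr0 _) h2]
    refine hx₀ _ ?_
    have h3 : Continuous fun x => r (g • x) := hrc.comp (continuous_const_smul g)
    refine h3.continuousAt.preimage_mem_nhds (isOpen_ne.mem_nhds ?_)
    exact (hrL (g * g₀) ⟨g, hg, rfl⟩).ne'
  exact_mod_cast hpos.ne'

/-- Functions pulled back from `G₁ ⧸ D₁` are constant on fibres and come out of the integral, so `u`
times the pullback of `φ / P u` is a preimage of `φ`. -/
theorem fiberPush_surjective (hD : IsClosed (D : Set G)) (hl : IsFiberMeasure p hpD l)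
    (hp : ContMDiff 𝓘(ℝ, E) 𝓘(ℝ, E₁) ∞ p) (hopen : IsOpenMap p)
    (hsurj : Function.Surjective p) :
    Function.Surjective (fiberPush (𝕜 := 𝕜) hl hp hopen hsurj) := by
  intro φ
  obtain ⟨u, hu⟩ := exists_fiberPush_ne_zero (𝕜 := 𝕜) hD hl hp hopen hsurj φ.2.2
  set P := fiberPush (𝕜 := 𝕜) hl hp hopen hsurj with hP
  -- `P u` may vanish off the support of `φ`, but there `φ` is locally zero, and so is the quotient
  -- since `0 / 0 = 0`.
  have hψs : ContMDiff 𝓘(ℝ, E₁) 𝓘(ℝ, 𝕜) ∞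
      fun z : G₁ => φ.1 (z : G₁ ⧸ D₁) / (P u).1 (z : G₁ ⧸ D₁) := by
    intro z
    by_cases hz : (z : G₁ ⧸ D₁) ∈ tsupport φ.1
    · have h1 : ContDiffAt ℝ ∞ (fun t : 𝕜 × 𝕜 => t.1 / t.2)
          (φ.1 (z : G₁ ⧸ D₁), (P u).1 (z : G₁ ⧸ D₁)) := by
        simp only [div_eq_mul_inv]
        exact contDiffAt_fst.mul (contDiffAt_snd.fun_inv (hu _ hz))
      exact h1.contMDiffAt.comp z ((φ.2.1 z).prodMk_space ((P u).2.1 z))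
    · have h1 : ∀ᶠ z' : G₁ in 𝓝 z, φ.1 (z' : G₁ ⧸ D₁) = 0 :=
        (QuotientGroup.continuous_mk.tendsto z).eventually
          (notMem_tsupport_iff_eventuallyEq.mp hz)
      refine (contMDiffAt_const (c := (0 : 𝕜))).congr_of_eventuallyEq ?_
      filter_upwards [h1] with z' hz'
      rw [hz', zero_div]
  let ψ : G₁ ⧸ D₁ → 𝕜 := fun y => φ.1 y / (P u).1 y
  let f : testFunctions 𝕜 E D := ⟨fun x => u.1 x * ψ (quotientMap p hpD x),
    (contDiff_mul (𝕜 := ℝ) (𝔸 := 𝕜)).contMDiff.comp (u.2.1.prodMk_space (hψs.comp hp)),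
    u.2.2.mul_right⟩
  refine ⟨f, Subtype.ext (funext fun y => ?_)⟩
  induction y using QuotientGroup.induction_on with
  | H z =>
  obtain ⟨g, rfl⟩ := hsurj z
  have h1 : (P f).1 (p g : G₁ ⧸ D₁) = (P u).1 (p g : G₁ ⧸ D₁) * ψ (p g : G₁ ⧸ D₁) := by
    rw [hP, fiberPush_mk, fiberPush_mk, ← integral_mul_const]
    refine integral_congr_ae ?_
    filter_upwards [hl.ae_eq] with x hx
    have h2 : quotientMap p hpD (g • x) = (p g : G₁ ⧸ D₁) := by
      rw [quotientMap_smul, hx]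
      change ((p g * 1 : G₁) : G₁ ⧸ D₁) = _
      rw [mul_one]
    simp only [f, h2]
  rw [h1]
  by_cases hz : (p g : G₁ ⧸ D₁) ∈ tsupport φ.1
  · exact mul_div_cancel₀ _ (hu _ hz)
  · have h2 := image_eq_zero_of_notMem_tsupport hz
    simp only [ψ, h2, zero_div, mul_zero]

end Surjectivity

end HomogeneousFlow

end SurjectivityOfFiberIntegration

/-! ### Existence of the fibre measure -/

section FiberMeasureExistence

open MeasureTheory

namespace HomogeneousFlow

/-- If `G ⧸ D` carries a finite invariant measure, then so does the fibre of
`G ⧸ D → G₁ ⧸ D₁` over the base point. -/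
theorem exists_isFiberMeasure {G : Type*} [Group G] [TopologicalSpace G] [IsTopologicalGroup G]
    [LocallyCompactSpace G] [SecondCountableTopology G] {D : Subgroup G}
    {G₁ : Type*} [Group G₁] [TopologicalSpace G₁] [IsTopologicalGroup G₁] {D₁ : Subgroup G₁}
    [SecondCountableTopology G₁] [T2Space (G₁ ⧸ D₁)] [T2Space (G ⧸ D)]
    [MeasurableSpace (G ⧸ D)] [BorelSpace (G ⧸ D)]
    (μ : Measure (G ⧸ D)) [IsFiniteMeasure μ] (hμ : μ ≠ 0) [SMulInvariantMeasure G (G ⧸ D) μ]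
    (p : G →* G₁) (hp : Continuous p) (hsurj : Function.Surjective p) (hpD : D ≤ D₁.comap p) :
    ∃ l : Measure (G ⧸ D), IsFiberMeasure p hpD l := by
  -- Through `p` the group `G` acts transitively on `G₁ ⧸ D₁`, and the stabilizer of the base point
  -- is `p⁻¹(D₁)`.
  let _ : MulAction G (G₁ ⧸ D₁) := MulAction.compHom _ p
  have hsmul : ∀ (g : G) (y : G₁ ⧸ D₁), g • y = p g • y := fun _ _ => rfl
  have : ContinuousSMul G (G₁ ⧸ D₁) := MulAction.continuousSMul_compHom hp
  have : MulAction.IsPretransitive G (G₁ ⧸ D₁) := ⟨fun x y => by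
    obtain ⟨z, hz⟩ := MulAction.exists_smul_eq G₁ x y
    obtain ⟨g, rfl⟩ := hsurj z
    exact ⟨g, hz⟩⟩
  let _ : MeasurableSpace G := borel G
  have : BorelSpace G := ⟨rfl⟩
  let _ : MeasurableSpace (G₁ ⧸ D₁) := borel _
  have : BorelSpace (G₁ ⧸ D₁) := ⟨rfl⟩
  have := standardBorelSpace_of_locallyCompact (G ⧸ D)
  obtain ⟨l, hl1, hl2, hl3⟩ := exists_stabilizer_invariant_measure (G := G) μ hμ
    (continuous_quotientMap p hp hpD) (quotientMap_smul p hpD) ((1 : G₁) : G₁ ⧸ D₁)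
  refine ⟨l, hl1, hl2, fun g hg => hl3 g ?_⟩
  rw [hsmul]
  change ((p g * 1 : G₁) : G₁ ⧸ D₁) = _
  rw [mul_one, QuotientGroup.eq, mul_one]
  exact inv_mem hg

end HomogeneousFlow

end FiberMeasureExistence

/-! ### Transfer of invariant distributions -/

theorem mainTheorem8 {𝕜 : Type*} [RCLike 𝕜]
    {E : Type*} [NormedAddCommGroup E] [NormedSpace ℝ E] [FiniteDimensional ℝ E]
    {G : Type*} [Group G] [TopologicalSpace G] [ChartedSpace E G] [LieGroup 𝓘(ℝ, E) ∞ G]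
    [ConnectedSpace G]
    {E₁ : Type*} [NormedAddCommGroup E₁] [NormedSpace ℝ E₁] [FiniteDimensional ℝ E₁]
    {G₁ : Type*} [Group G₁] [TopologicalSpace G₁] [ChartedSpace E₁ G₁]
    [LieGroup 𝓘(ℝ, E₁) ∞ G₁]
    (D : Subgroup G) (hD : HomogeneousFlow.IsFiniteVolumeSpace D)
    (γ : HomogeneousFlow.OneParameterSubgroup E G)
    (D₁ : Subgroup G₁) (hD₁ : IsClosed (D₁ : Set G₁))
    (γ₁ : HomogeneousFlow.OneParameterSubgroup E₁ G₁)
    (p : G →* G₁) (hp : ContMDiff 𝓘(ℝ, E) 𝓘(ℝ, E₁) ∞ p) (hp_surj : Function.Surjective p)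
    (hpD : D ≤ D₁.comap p) (hpγ : ∀ t : ℝ, p (γ.toFun t) = γ₁.toFun t)
    (h : HomogeneousFlow.HasCountablyManyInvariantDistributions 𝕜 D₁ γ₁) :
    HomogeneousFlow.HasCountablyManyInvariantDistributions 𝕜 D γ := by
  have : IsTopologicalGroup G := topologicalGroup_of_lieGroup 𝓘(ℝ, E) ∞
  have : IsTopologicalGroup G₁ := topologicalGroup_of_lieGroup 𝓘(ℝ, E₁) ∞
  have := LieGroup.t2Space E G
  have := LieGroup.t2Space E₁ G₁
  have := LieGroup.locallyCompactSpace E G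
  have := LieGroup.locallyCompactSpace E₁ G₁
  have := LieGroup.sigmaCompactSpace E G
  have : SecondCountableTopology G := ChartedSpace.secondCountable_of_sigmaCompact E G
  -- Connectedness of `G` enters through σ-compactness, which the open mapping theorem for groups
  -- requires.
  have hopen : IsOpenMap p := p.isOpenMap_of_sigmaCompact hp_surj hp.continuous
  have : SecondCountableTopology G₁ :=
    (hopen.isQuotientMap hp.continuous hp_surj).secondCountableTopology hopen
  have hDc := hD.isClosed
  let _ : MeasurableSpace (G ⧸ D) := borel _
  have : BorelSpace (G ⧸ D) := ⟨rfl⟩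
  obtain ⟨μ, hμ1, hμ0, hμ2⟩ := hD.exists_measure
  obtain ⟨l, hl⟩ := HomogeneousFlow.exists_isFiberMeasure μ hμ0 p hp.continuous hp_surj hpD
  obtain ⟨T, hT, hTinv⟩ := h
  refine ⟨fun n => HomogeneousFlow.distributionsPullback hl hp hopen hp_surj (T n), ?_,
    fun n => HomogeneousFlow.isInvariant_distributionsPullback hl hp hopen hp_surj γ γ₁ hpγ
      (hTinv n)⟩
  have hinj := HomogeneousFlow.distributionsPullback_injective hl hp hopen hp_surj
      (HomogeneousFlow.fiberPush_surjective (𝕜 := 𝕜) hDc hl hp hopen hp_surj)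
  exact hT.map_injOn (HomogeneousFlow.distributionsPullback hl hp hopen hp_surj) hinj.injOn
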